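/- Let $R$ be an integral domain with quotient field $K$, and let $\ast$ be a star operation of finite type on $R$, i.e. a map $I\mapsto I^{\ast}$ on the nonzero fractional ideals of $R$ such that, for all nonzero fractional ideals $I,J$ and all $0\neq a\in K$: $R^{\ast}=R$ and $(aI)^{\ast}=aI^{\ast}$; $I\subseteq I^{\ast}$, and $I\subseteq J$ implies $I^{\ast}\subseteq J^{\ast}$; $(I^{\ast})^{\ast}=I^{\ast}$; and $I^{\ast}=\bigcup\{J^{\ast} : 0\neq J\subseteq I,\ J \text{ finitely generated}\}$. A nonzero ideal $I$ of $R$ is a $\ast$-ideal if $I^{\ast}=I$, and it is $\ast$-invertible if $(II^{-1})^{\ast}=R$, where $I^{-1}=\{x\in K : xI\subseteq R\}$. A $\ast$-prime is a prime ideal that is a $\ast$-ideal. A $\ast$-packet is a $\ast$-invertible $\ast$-ideal $I\subseteq R$ that has a unique minimal prime ideal. $R$ is a $\ast$-URD if every $\ast$-invertible $\ast$-ideal $X\subsetneq R$ can be written, uniquely up to order, as $X=(X_1X_2\cdots X_n)^{\ast}$ with finitely many $\ast$-packets $X_i$ such that $(X_i+X_j)^{\ast}=R$ for $i\neq j$.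 The $t$-operation is the star operation $I_t=\bigcup\{(J^{-1})^{-1} : 0\neq J\subseteq I,\ J\text{ finitely generated}\}$. Then the following conditions are equivalent: (i) $R$ is a $\ast$-URD and each $\ast$-packet is a $\ast$-power of a $\ast$-prime ideal, i.e. of the form $(P^{n})^{\ast}$ with $P$ a $\ast$-prime and $n\geq 1$; (ii) $R$ is a Krull domain and $\ast=t$. Here $R$ is a Krull domain if $R_P$ is a discrete valuation ring for every height-one prime $P$, $R=\bigcap_P R_P$ (the intersection over all height-one primes, inside $K$), and each nonzero element of $R$ lies in only finitely many height-one primes; in particular a field is a Krull domain. -/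

import Mathlib

open scoped nonZeroDivisors

/-- A star operation on the integral domain `R` with quotient field `K`. It is a map on the nonzero
fractional ideals; it is extended to the zero ideal by `0 ↦ 0`, which makes it total. -/
@[ext]
structure StarOperation (R K : Type*) [CommRing R] [IsDomain R] [Field K] [Algebra R K]
    [IsFractionRing R K] where
  /-- the map `I ↦ I^*` -/
  toFun : FractionalIdeal R⁰ K → FractionalIdeal R⁰ K
  map_zero' : toFun 0 = 0
  map_one' : toFun 1 = 1
  map_spanSingleton_mul' : ∀ (a : K), a ≠ 0 → ∀ I : FractionalIdeal R⁰ K,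
    toFun (FractionalIdeal.spanSingleton R⁰ a * I) = FractionalIdeal.spanSingleton R⁰ a * toFun I
  le_map' : ∀ I : FractionalIdeal R⁰ K, I ≤ toFun I
  map_mono' : ∀ I J : FractionalIdeal R⁰ K, I ≤ J → toFun I ≤ toFun J
  map_map' : ∀ I : FractionalIdeal R⁰ K, toFun (toFun I) = toFun I

namespace StarOperation

variable {R K : Type*} [CommRing R] [IsDomain R] [Field K] [Algebra R K] [IsFractionRing R K]

instance : CoeFun (StarOperation R K)
    (fun _ => FractionalIdeal R⁰ K → FractionalIdeal R⁰ K) := ⟨StarOperation.toFun⟩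

/-- `σ` is of finite type: `I^σ` is the union of the `J^σ`, `J ⊆ I` finitely generated. -/
def IsFiniteType (σ : StarOperation R K) : Prop :=
  ∀ I : FractionalIdeal R⁰ K, ∀ x : K,
    x ∈ σ I ↔ ∃ J : FractionalIdeal R⁰ K, J ≤ I ∧ (J : Submodule R K).FG ∧ x ∈ σ J

/-- The ideal `⋃ J^σ`, over the finitely generated fractional ideals `J ⊆ I`. -/
def finiteTypeClosure (σ : StarOperation R K) (I : FractionalIdeal R⁰ K) :
    FractionalIdeal R⁰ K :=
  ⟨{ carrier := {x | ∃ J : FractionalIdeal R⁰ K, J ≤ I ∧ (J : Submodule R K).FG ∧ x ∈ σ J}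
     zero_mem' := ⟨0, FractionalIdeal.zero_le _, by simpa using Submodule.fg_bot, Submodule.zero_mem _⟩
     add_mem' := by
      rintro x y ⟨J, hJ, hJf, hx⟩ ⟨J', hJ', hJf', hy⟩
      refine ⟨J ⊔ J', sup_le hJ hJ', ?_, ?_⟩
      · rw [FractionalIdeal.coe_sup]; exact hJf.sup hJf'
      · exact Submodule.add_mem _ (σ.map_mono' _ _ le_sup_left hx)
          (σ.map_mono' _ _ le_sup_right hy)
     smul_mem' := by
      rintro c x ⟨J, hJ, hJf, hx⟩
      exact ⟨J, hJ, hJf, Submodule.smul_mem _ c hx⟩ },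
    by
      obtain ⟨a, ha, h⟩ := (σ I).isFractional
      refine ⟨a, ha, ?_⟩
      rintro x ⟨J, hJ, -, hx⟩
      exact h x (σ.map_mono' _ _ hJ hx)⟩

theorem mem_finiteTypeClosure (σ : StarOperation R K) (I : FractionalIdeal R⁰ K) (x : K) :
    x ∈ σ.finiteTypeClosure I ↔
      ∃ J : FractionalIdeal R⁰ K, J ≤ I ∧ (J : Submodule R K).FG ∧ x ∈ σ J := Iff.rfl

theorem finiteTypeClosure_le (σ : StarOperation R K) (I : FractionalIdeal R⁰ K) :
    σ.finiteTypeClosure I ≤ σ I := by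
  rintro x ⟨J, hJ, -, hx⟩
  exact σ.map_mono' _ _ hJ hx

theorem le_finiteTypeClosure (σ : StarOperation R K) (I : FractionalIdeal R⁰ K) :
    I ≤ σ.finiteTypeClosure I := by
  intro x hx
  refine ⟨FractionalIdeal.spanSingleton R⁰ x, ?_, ?_, ?_⟩
  · exact FractionalIdeal.spanSingleton_le_iff_mem.mpr hx
  · rw [FractionalIdeal.coe_spanSingleton]; exact Submodule.fg_span_singleton x
  · exact σ.le_map' _ (FractionalIdeal.mem_spanSingleton_self _ x)

theorem finiteTypeClosure_mono (σ : StarOperation R K) {I I' : FractionalIdeal R⁰ K}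
    (h : I ≤ I') : σ.finiteTypeClosure I ≤ σ.finiteTypeClosure I' := by
  rintro x ⟨J, hJ, hJf, hx⟩
  exact ⟨J, hJ.trans h, hJf, hx⟩

/-- A finitely generated subideal of `⋃ J^σ` lies in a single `J^σ`. -/
theorem exists_le_of_fg (σ : StarOperation R K) (I : FractionalIdeal R⁰ K)
    (N : Submodule R K) (hN : N.FG) (hle : N ≤ (σ.finiteTypeClosure I : Submodule R K)) :
    ∃ J : FractionalIdeal R⁰ K, J ≤ I ∧ (J : Submodule R K).FG ∧ N ≤ (σ J : Submodule R K) := by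
  induction N, hN using Submodule.fg_induction with
  | singleton x =>
    obtain ⟨J, hJ, hJf, hx⟩ := hle (Submodule.mem_span_singleton_self x)
    exact ⟨J, hJ, hJf, (Submodule.span_singleton_le_iff_mem _ _).mpr hx⟩
  | sup N₁ N₂ _ _ h₁ h₂ =>
    obtain ⟨J₁, hJ₁, hf₁, hl₁⟩ := h₁ (le_sup_left.trans hle)
    obtain ⟨J₂, hJ₂, hf₂, hl₂⟩ := h₂ (le_sup_right.trans hle)
    refine ⟨J₁ ⊔ J₂, sup_le hJ₁ hJ₂, ?_, sup_le ?_ ?_⟩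
    · rw [FractionalIdeal.coe_sup]; exact hf₁.sup hf₂
    · exact hl₁.trans (σ.map_mono' _ _ le_sup_left)
    · exact hl₂.trans (σ.map_mono' _ _ le_sup_right)

theorem spanSingleton_mul_fg {R K : Type*} [CommRing R] [Field K] [Algebra R K]
    [IsFractionRing R K] (a : K) {J : FractionalIdeal R⁰ K} (hJ : (J : Submodule R K).FG) :
    ((FractionalIdeal.spanSingleton R⁰ a * J : FractionalIdeal R⁰ K) : Submodule R K).FG := by
  rw [FractionalIdeal.coe_mul, FractionalIdeal.coe_spanSingleton]
  exact (Submodule.fg_span_singleton a).mul hJ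

theorem spanSingleton_mul_finiteTypeClosure_le (σ : StarOperation R K) (a : K) (ha : a ≠ 0)
    (I : FractionalIdeal R⁰ K) :
    FractionalIdeal.spanSingleton R⁰ a * σ.finiteTypeClosure I ≤
      σ.finiteTypeClosure (FractionalIdeal.spanSingleton R⁰ a * I) := by
  rw [FractionalIdeal.spanSingleton_mul_le_iff]
  rintro x ⟨J, hJ, hJf, hx⟩
  refine ⟨FractionalIdeal.spanSingleton R⁰ a * J, mul_le_mul_right hJ _,
    spanSingleton_mul_fg a hJf, ?_⟩
  rw [σ.map_spanSingleton_mul' a ha]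
  exact FractionalIdeal.mul_mem_mul (FractionalIdeal.mem_spanSingleton_self _ a) hx

/-- The star operation of finite type `σ_f` associated to `σ`. -/
def finiteType (σ : StarOperation R K) : StarOperation R K where
  toFun := σ.finiteTypeClosure
  map_zero' := le_antisymm ((σ.finiteTypeClosure_le 0).trans σ.map_zero'.le) (FractionalIdeal.zero_le _)
  map_one' := le_antisymm ((σ.finiteTypeClosure_le 1).trans σ.map_one'.le)
    (σ.le_finiteTypeClosure 1)
  map_spanSingleton_mul' := by
    intro a ha I
    refine le_antisymm ?_ (σ.spanSingleton_mul_finiteTypeClosure_le a ha I)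
    have h := σ.spanSingleton_mul_finiteTypeClosure_le a⁻¹ (inv_ne_zero ha)
      (FractionalIdeal.spanSingleton R⁰ a * I)
    have e : ∀ L : FractionalIdeal R⁰ K, FractionalIdeal.spanSingleton R⁰ a⁻¹ *
        (FractionalIdeal.spanSingleton R⁰ a * L) = L := by
      intro L
      rw [← mul_assoc, FractionalIdeal.spanSingleton_mul_spanSingleton, inv_mul_cancel₀ ha,
        FractionalIdeal.spanSingleton_one, one_mul]
    have e' : ∀ L : FractionalIdeal R⁰ K, FractionalIdeal.spanSingleton R⁰ a *
        (FractionalIdeal.spanSingleton R⁰ a⁻¹ * L) = L := by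
      intro L
      rw [← mul_assoc, FractionalIdeal.spanSingleton_mul_spanSingleton, mul_inv_cancel₀ ha,
        FractionalIdeal.spanSingleton_one, one_mul]
    rw [e] at h
    have h' := mul_le_mul_right h (FractionalIdeal.spanSingleton R⁰ a)
    rwa [e'] at h'
  le_map' := σ.le_finiteTypeClosure
  map_mono' := fun _ _ h => σ.finiteTypeClosure_mono h
  map_map' := by
    intro I
    refine le_antisymm ?_ (σ.le_finiteTypeClosure _)
    rintro x ⟨J, hJ, hJf, hx⟩
    obtain ⟨J', hJ', hJf', hle⟩ := σ.exists_le_of_fg I J hJf hJ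
    have h2 : σ J ≤ σ J' := (σ.map_mono' _ _ hle).trans (σ.map_map' J').le
    exact ⟨J', hJ', hJf', h2 hx⟩

end StarOperation

theorem FractionalIdeal.inv_ne_zero_of_ne_zero {R K : Type*} [CommRing R] [IsDomain R] [Field K]
    [Algebra R K] [IsFractionRing R K] {I : FractionalIdeal R⁰ K} (hI : I ≠ 0) : I⁻¹ ≠ 0 := by
  intro h
  obtain ⟨a, ha, h'⟩ := I.isFractional
  have hm : algebraMap R K a ∈ I⁻¹ := by
    rw [FractionalIdeal.mem_inv_iff hI]
    intro y hy
    obtain ⟨r, hr⟩ := h' y hy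
    rw [FractionalIdeal.mem_one_iff]
    exact ⟨r, by rw [hr, Algebra.smul_def]⟩
  rw [h, FractionalIdeal.mem_zero_iff] at hm
  exact nonZeroDivisors.ne_zero ha
    (IsFractionRing.injective R K (by rw [hm, _root_.map_zero]))

theorem FractionalIdeal.le_inv_inv_self {R K : Type*} [CommRing R] [IsDomain R] [Field K]
    [Algebra R K] [IsFractionRing R K] (I : FractionalIdeal R⁰ K) : I ≤ I⁻¹⁻¹ := by
  by_cases hI : I = 0
  · rw [hI]; exact FractionalIdeal.zero_le _
  intro x hx
  refine (FractionalIdeal.mem_inv_iff (FractionalIdeal.inv_ne_zero_of_ne_zero hI)).mpr ?_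
  intro y hy
  rw [mul_comm]
  exact (FractionalIdeal.mem_inv_iff hI).mp hy x hx

theorem FractionalIdeal.inv_inv_mono {R K : Type*} [CommRing R] [IsDomain R] [Field K]
    [Algebra R K] [IsFractionRing R K] {I J : FractionalIdeal R⁰ K} (h : I ≤ J) :
    I⁻¹⁻¹ ≤ J⁻¹⁻¹ := by
  by_cases hI : I = 0
  · rw [hI, FractionalIdeal.inv_zero', FractionalIdeal.inv_zero']; exact FractionalIdeal.zero_le _
  have hJ : J ≠ 0 := fun h0 => hI (le_antisymm (h.trans h0.le) (FractionalIdeal.zero_le _))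
  exact FractionalIdeal.inv_anti_mono (FractionalIdeal.inv_ne_zero_of_ne_zero hJ)
    (FractionalIdeal.inv_ne_zero_of_ne_zero hI) (FractionalIdeal.inv_anti_mono hI hJ h)

theorem FractionalIdeal.inv_inv_inv_self {R K : Type*} [CommRing R] [IsDomain R] [Field K]
    [Algebra R K] [IsFractionRing R K] (I : FractionalIdeal R⁰ K) : I⁻¹⁻¹⁻¹ = I⁻¹ := by
  by_cases hI : I = 0
  · simp only [hI, FractionalIdeal.inv_zero']
  refine le_antisymm ?_ (FractionalIdeal.le_inv_inv_self _)
  exact FractionalIdeal.inv_anti_mono hI (FractionalIdeal.inv_ne_zero_of_ne_zero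
    (FractionalIdeal.inv_ne_zero_of_ne_zero hI)) (FractionalIdeal.le_inv_inv_self I)

theorem FractionalIdeal.inv_spanSingleton_mul {R K : Type*} [CommRing R] [IsDomain R] [Field K]
    [Algebra R K] [IsFractionRing R K] (a : K) (ha : a ≠ 0) (I : FractionalIdeal R⁰ K) :
    (FractionalIdeal.spanSingleton R⁰ a * I)⁻¹ = FractionalIdeal.spanSingleton R⁰ a⁻¹ * I⁻¹ := by
  by_cases hI : I = 0
  · simp only [hI, mul_zero, FractionalIdeal.inv_zero']
  have hs : FractionalIdeal.spanSingleton R⁰ a * I ≠ 0 := by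
    intro h
    obtain ⟨y, hy, hy0⟩ : ∃ y ∈ I, y ≠ 0 := by
      by_contra! hc
      exact hI (FractionalIdeal.eq_zero_iff.mpr hc)
    have hm : a * y ∈ FractionalIdeal.spanSingleton R⁰ a * I :=
      FractionalIdeal.mul_mem_mul (FractionalIdeal.mem_spanSingleton_self _ a) hy
    rw [h, FractionalIdeal.mem_zero_iff] at hm
    exact mul_ne_zero ha hy0 hm
  ext x
  rw [FractionalIdeal.mem_inv_iff hs, FractionalIdeal.mem_singleton_mul]
  constructor
  · intro h
    refine ⟨a * x, (FractionalIdeal.mem_inv_iff hI).mpr fun y hy => ?_, ?_⟩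
    · have := h (a * y)
        (FractionalIdeal.mul_mem_mul (FractionalIdeal.mem_spanSingleton_self _ a) hy)
      rwa [show a * x * y = x * (a * y) by ring]
    · rw [← mul_assoc, inv_mul_cancel₀ ha, one_mul]
  · rintro ⟨z, hz, rfl⟩ y hy
    obtain ⟨w, hw, rfl⟩ := FractionalIdeal.mem_singleton_mul.mp hy
    have := (FractionalIdeal.mem_inv_iff hI).mp hz w hw
    rwa [show a⁻¹ * z * (a * w) = (a⁻¹ * a) * (z * w) by ring, inv_mul_cancel₀ ha, one_mul]

/-- The `v`-operation `I ↦ (I⁻¹)⁻¹`. -/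
noncomputable def vOperation (R K : Type*) [CommRing R] [IsDomain R] [Field K] [Algebra R K]
    [IsFractionRing R K] : StarOperation R K where
  toFun I := I⁻¹⁻¹
  map_zero' := by simp only [FractionalIdeal.inv_zero']
  map_one' := by simp only [inv_one]
  map_spanSingleton_mul' a ha I := by
    rw [FractionalIdeal.inv_spanSingleton_mul a ha,
      FractionalIdeal.inv_spanSingleton_mul a⁻¹ (inv_ne_zero ha), inv_inv]
  le_map' := FractionalIdeal.le_inv_inv_self
  map_mono' _ _ h := FractionalIdeal.inv_inv_mono h
  map_map' I := by simp only [FractionalIdeal.inv_inv_inv_self]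

/-- The `t`-operation: the star operation of finite type associated to `v`. -/
noncomputable def tOperation (R K : Type*) [CommRing R] [IsDomain R] [Field K] [Algebra R K]
    [IsFractionRing R K] : StarOperation R K := (vOperation R K).finiteType

namespace StarOperation

variable {R K : Type*} [CommRing R] [IsDomain R] [Field K] [Algebra R K] [IsFractionRing R K]

/-- `I` is a (nonzero, integral) `σ`-ideal: `I^σ = I`. -/
def IsStarIdeal (σ : StarOperation R K) (I : Ideal R) : Prop :=
  I ≠ ⊥ ∧ σ (I : FractionalIdeal R⁰ K) = (I : FractionalIdeal R⁰ K)

/-- `I` is `σ`-invertible: `(I I⁻¹)^σ = R`. -/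
def IsStarInvertible (σ : StarOperation R K) (I : Ideal R) : Prop :=
  I ≠ ⊥ ∧ σ ((I : FractionalIdeal R⁰ K) * (I : FractionalIdeal R⁰ K)⁻¹) = 1

/-- `P` is a `σ`-prime: a prime ideal that is a `σ`-ideal. -/
def IsStarPrime (σ : StarOperation R K) (P : Ideal R) : Prop :=
  P.IsPrime ∧ σ.IsStarIdeal P

/-- `I` and `J` are `σ`-comaximal: `(I + J)^σ = R`. -/
def StarComaximal (σ : StarOperation R K) (I J : Ideal R) : Prop :=
  σ ((I + J : Ideal R) : FractionalIdeal R⁰ K) = 1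

/-- `I` is a `σ`-packet: a `σ`-invertible `σ`-ideal of `R` with a unique minimal prime. -/
def IsPacket (σ : StarOperation R K) (I : Ideal R) : Prop :=
  σ.IsStarIdeal I ∧ σ.IsStarInvertible I ∧ ∃! P : Ideal R, P ∈ I.minimalPrimes

/-- The finite family `s` (repetitions allowed, order irrelevant) consists of mutually
`σ`-comaximal `σ`-packets and its `σ`-product is `X`. -/
def IsPacketFactorization (σ : StarOperation R K) (X : Ideal R) (s : Multiset (Ideal R)) : Prop :=
  (∀ I ∈ s, σ.IsPacket I) ∧ s.Pairwise σ.StarComaximal ∧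
    (X : FractionalIdeal R⁰ K) = σ ((s.prod : Ideal R) : FractionalIdeal R⁰ K)

/-- `R` is a `σ`-URD: every proper `σ`-invertible `σ`-ideal is uniquely, up to order, a
`σ`-product of finitely many mutually `σ`-comaximal `σ`-packets. -/
def IsURD (σ : StarOperation R K) : Prop :=
  ∀ X : Ideal R, X ≠ ⊤ → σ.IsStarIdeal X → σ.IsStarInvertible X →
    ∃! s : Multiset (Ideal R), σ.IsPacketFactorization X s

/-- `I` is a `σ`-power of a `σ`-prime: `I = (P ^ n)^σ` with `P` a `σ`-prime and `n ≥ 1`. -/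
def IsStarPowerOfStarPrime (σ : StarOperation R K) (I : Ideal R) : Prop :=
  ∃ (P : Ideal R) (n : ℕ), σ.IsStarPrime P ∧ 1 ≤ n ∧
    (I : FractionalIdeal R⁰ K) = σ ((P ^ n : Ideal R) : FractionalIdeal R⁰ K)

end StarOperation

/-- `R` is a Krull domain: `R_P` is a discrete valuation ring for each height-one prime `P`,
`R` is the intersection of these `R_P` in its quotient field, and every nonzero element of `R` lies
in only finitely many height-one primes. (Fields are Krull domains.) -/
structure IsKrullDomain (R : Type*) [CommRing R] [IsDomain R] : Prop where
  isDVR : ∀ (P : Ideal R) [P.IsPrime], P.height = 1 →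
    IsDiscreteValuationRing (Localization.AtPrime P)
  mem_of_forall : ∀ x : FractionRing R,
    (∀ P : Ideal R, P.IsPrime → P.height = 1 → ∃ a s : R, s ∉ P ∧
      x = algebraMap R (FractionRing R) a / algebraMap R (FractionRing R) s) →
    ∃ r : R, algebraMap R (FractionRing R) r = x
  finite : ∀ x : R, x ≠ 0 → {P : Ideal R | P.IsPrime ∧ P.height = 1 ∧ x ∈ P}.Finite

set_option linter.unusedSectionVars false

/-! Both conditions are equivalent to `HasPrimeFactorization`: each nonzero principal ideal is a
σ-product of σ-invertible σ-primes, each of which is σ-comaximal to every ideal it does not contain.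
Such primes turn out to be exactly the height-one primes, and σ-multiplicity at them plays the role
of the valuation.

(i) gives factorization: packets are σ-powers of σ-primes, and a σ-prime with a σ-invertible power
is itself σ-invertible. Such primes are incomparable. Factoring `(PQ)^σ` into comaximal packets then
forces distinct ones to be comaximal (`starComaximal_of_isURD`), and factoring a principal ideal
`(x)` with `x ∉ P` extends this to every ideal not inside `P`. Uniqueness of the factorization is
not needed here.

Factorization gives (i): a σ-invertible ideal divides a principal one, so it is a σ-product of the
same primes. Grouping equal primes yields the packets, and cancellation makes the exponents unique.

Factorization gives (ii): σ-invertibility makes `P` principal locally at `P`, so `R_P` is a discrete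
valuation ring. An ideal lying in none of these primes has σ-closure `R` (`map_eq_one`); this gives
`R = ⋂ R_P` and the σ-invertibility of finitely generated ideals. On σ-invertible ideals σ agrees
with `v`, so finite type forces `σ = t`.

(ii) gives factorization: in a Krull domain every nonzero ideal contains a finitely generated one
with the same inverse (`exists_fg_le`, `inv_eq_of_local_generators`). Hence `t = v` on integral
ideals, every nonzero ideal is `t`-invertible, and height-one primes can be divided out one at a
time. -/

namespace FractionalIdeal

variable {R K : Type*} [CommRing R] [IsDomain R] [Field K] [Algebra R K] [IsFractionRing R K]

theorem mul_self_inv_le_one (A : FractionalIdeal R⁰ K) : A * A⁻¹ ≤ 1 := by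
  rw [inv_eq]
  exact mul_one_div_le_one

theorem le_inv_of_mul_le_one {A B : FractionalIdeal R⁰ K} (hA : A ≠ 0) (h : A * B ≤ 1) :
    B ≤ A⁻¹ := fun x hx => (mem_inv_iff hA).mpr fun y hy => by
  rw [mul_comm]
  exact h (mul_mem_mul hy hx)

theorem mul_le_coeIdeal_iff {P : Ideal R} (hP : P.IsPrime) {A B : FractionalIdeal R⁰ K}
    (hA : A ≤ 1) (hB : B ≤ 1) : A * B ≤ P ↔ A ≤ P ∨ B ≤ P := by
  obtain ⟨I, rfl⟩ := le_one_iff_exists_coeIdeal.mp hA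
  obtain ⟨J, rfl⟩ := le_one_iff_exists_coeIdeal.mp hB
  rw [← coeIdeal_mul, coeIdeal_le_coeIdeal, coeIdeal_le_coeIdeal, coeIdeal_le_coeIdeal,
    hP.mul_le]

end FractionalIdeal

/-! ### Calculus of star operations: products, σ-invertibility, σ-comaximality. -/

namespace StarOperation

open FractionalIdeal

variable {R K : Type*} [CommRing R] [IsDomain R] [Field K] [Algebra R K] [IsFractionRing R K]
  (σ : StarOperation R K)

theorem le_map (A : FractionalIdeal R⁰ K) : A ≤ σ A := σ.le_map' A

theorem map_one : σ 1 = 1 := σ.map_one'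

variable {σ} in
theorem map_mono {A B : FractionalIdeal R⁰ K} (h : A ≤ B) : σ A ≤ σ B := σ.map_mono' A B h

theorem map_map (A : FractionalIdeal R⁰ K) : σ (σ A) = σ A := σ.map_map' A

variable {σ} in
theorem map_le_of_le {A B : FractionalIdeal R⁰ K} (h : A ≤ σ B) : σ A ≤ σ B :=
  (map_mono h).trans (σ.map_map B).le

variable {σ} in
theorem map_le_one {A : FractionalIdeal R⁰ K} (h : A ≤ 1) : σ A ≤ 1 :=
  (map_mono h).trans σ.map_one.le

variable {σ} in
theorem map_le_of_isStarIdeal {A : FractionalIdeal R⁰ K} {I : Ideal R} (hI : σ.IsStarIdeal I)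
    (h : A ≤ I) : σ A ≤ I := (map_mono h).trans hI.2.le

variable {σ} in
theorem ne_zero_of_map_ne_zero {A : FractionalIdeal R⁰ K} (h : σ A ≠ 0) : A ≠ 0 := by
  rintro rfl
  exact h σ.map_zero'

theorem map_spanSingleton {a : K} (ha : a ≠ 0) :
    σ (spanSingleton R⁰ a) = spanSingleton R⁰ a := by
  simpa [σ.map_one] using σ.map_spanSingleton_mul' a ha 1

/-- For each nonzero `a ∈ A`, homogeneity and monotonicity give `a B^σ = (aB)^σ ⊆ (AB)^σ`. The rules
for σ of a product below rest on this. -/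
theorem map_mul_le (A B : FractionalIdeal R⁰ K) : A * σ B ≤ σ (A * B) := by
  rw [FractionalIdeal.mul_le]
  intro a ha b hb
  by_cases h0 : a = 0
  · rw [h0, zero_mul]
    exact Submodule.zero_mem _
  have h : spanSingleton R⁰ a * σ B ≤ σ (A * B) := by
    rw [← σ.map_spanSingleton_mul' a h0]
    exact map_mono (mul_le_mul' (spanSingleton_le_iff_mem.mpr ha) le_rfl)
  exact h (mul_mem_mul (mem_spanSingleton_self _ a) hb)

theorem map_mul_map (A B : FractionalIdeal R⁰ K) : σ (A * σ B) = σ (A * B) :=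
  le_antisymm (map_le_of_le (σ.map_mul_le A B)) (map_mono (mul_le_mul' le_rfl (σ.le_map B)))

theorem map_map_mul (A B : FractionalIdeal R⁰ K) : σ (σ A * B) = σ (A * B) := by
  rw [mul_comm, map_mul_map, mul_comm]

variable {σ} in
theorem map_mul_congr {A A' B B' : FractionalIdeal R⁰ K} (hA : σ A = σ A') (hB : σ B = σ B') :
    σ (A * B) = σ (A' * B') := by
  rw [← map_mul_map, ← map_map_mul, hA, hB, map_map_mul, map_mul_map]

theorem map_sup_map (A B : FractionalIdeal R⁰ K) : σ (A ⊔ σ B) = σ (A ⊔ B) :=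
  le_antisymm (map_le_of_le (sup_le (le_sup_left.trans (σ.le_map _)) (map_mono le_sup_right)))
    (map_mono (sup_le_sup_left (σ.le_map B) A))

variable {σ} in
theorem map_eq_one_of_le {A B : FractionalIdeal R⁰ K} (hA : σ A = 1) (h : A ≤ B) (hB : B ≤ 1) :
    σ B = 1 :=
  le_antisymm (map_le_one hB) (hA.symm.le.trans (map_mono h))

variable {σ} in
/-- If `σ (A * B) = 1` for some `B`, then `A` is `σ`-invertible. -/
theorem map_mul_inv_eq_one {A B : FractionalIdeal R⁰ K} (h : σ (A * B) = 1) :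
    σ (A * A⁻¹) = 1 := by
  have hAB : A * B ≠ 0 := ne_zero_of_map_ne_zero (h ▸ one_ne_zero)
  -- Since `AB ⊆ (AB)^σ = R`, any such `B` lies in `A⁻¹`, so `AB ⊆ AA⁻¹ ⊆ R`.
  refine map_eq_one_of_le h (mul_le_mul' le_rfl (le_inv_of_mul_le_one ?_ ?_))
    (mul_self_inv_le_one A)
  · rintro rfl
    simp at hAB
  · exact (σ.le_map _).trans h.le

variable {σ} in
theorem map_mul_mul_inv_eq_one {A B : FractionalIdeal R⁰ K} (hA : σ (A * A⁻¹) = 1)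
    (hB : σ (B * B⁻¹) = 1) : σ ((A * B) * (A * B)⁻¹) = 1 := by
  refine map_mul_inv_eq_one (B := A⁻¹ * B⁻¹) ?_
  rw [mul_mul_mul_comm, ← map_map_mul, hA, one_mul, hB]

variable {σ} in
theorem map_mul_cancel {A B C : FractionalIdeal R⁰ K} (hA : σ (A * A⁻¹) = 1)
    (h : σ (A * B) = σ (A * C)) : σ B = σ C := by
  have key : ∀ D : FractionalIdeal R⁰ K, σ (A⁻¹ * σ (A * D)) = σ D := fun D => by
    rw [map_mul_map, ← mul_assoc, mul_comm A⁻¹, ← map_map_mul, hA, one_mul]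
  rw [← key B, h, key C]

variable {σ} in
theorem map_inv_mul_mul {A : FractionalIdeal R⁰ K} (hA : σ (A * A⁻¹) = 1)
    (B : FractionalIdeal R⁰ K) : σ (A * (A⁻¹ * B)) = σ B := by
  rw [← mul_assoc, ← map_map_mul, hA, one_mul]

variable {σ} in
theorem map_mul_inv_congr {A B : FractionalIdeal R⁰ K} (h : σ A = σ B) (hA : σ (A * A⁻¹) = 1) :
    σ (B * B⁻¹) = 1 := by
  refine map_mul_inv_eq_one (B := A⁻¹) ?_
  rw [← map_map_mul, ← h, map_map_mul, hA]

variable {σ} in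
theorem map_pow_mul_inv_eq_one {A : FractionalIdeal R⁰ K} (hA : σ (A * A⁻¹) = 1) (n : ℕ) :
    σ (A ^ n * (A ^ n)⁻¹) = 1 := by
  induction n with
  | zero => simp [σ.map_one]
  | succ n ih => rw [pow_succ]; exact map_mul_mul_inv_eq_one ih hA

variable {σ} in
-- As for ordinary comaximality, `(A + B)(A + C) ⊆ A + BC`.
theorem map_sup_mul_eq_one {A B C : FractionalIdeal R⁰ K} (hA : A ≤ 1) (hB : B ≤ 1) (hC : C ≤ 1)
    (hAB : σ (A ⊔ B) = 1) (hAC : σ (A ⊔ C) = 1) : σ (A ⊔ B * C) = 1 := by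
  have h : σ ((A ⊔ B) * (A ⊔ C)) = 1 := by
    rw [← map_map_mul, hAB, one_mul, hAC]
  refine map_eq_one_of_le h ?_ (sup_le hA (mul_le_one' hB hC))
  simp only [sup_eq_add, add_mul, mul_add]
  simp only [← sup_eq_add]
  refine sup_le (sup_le ?_ ?_) (sup_le ?_ le_sup_right)
  · exact ((mul_le_mul' le_rfl hA).trans (mul_one _).le).trans le_sup_left
  · exact ((mul_le_mul' hB le_rfl).trans (one_mul _).le).trans le_sup_left
  · exact ((mul_le_mul' le_rfl hC).trans (mul_one _).le).trans le_sup_left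

variable {σ} in
theorem map_sup_prod_eq_one {A : FractionalIdeal R⁰ K} (hA : A ≤ 1) (s : Multiset (Ideal R))
    (h : ∀ I ∈ s, σ (A ⊔ (I : FractionalIdeal R⁰ K)) = 1) :
    σ (A ⊔ ((s.prod : Ideal R) : FractionalIdeal R⁰ K)) = 1 := by
  induction s using Multiset.induction with
  | empty =>
    simp only [Multiset.prod_zero, Ideal.one_eq_top, coeIdeal_top]
    exact map_eq_one_of_le σ.map_one le_sup_right (sup_le hA le_rfl)
  | cons I s ih =>
    rw [Multiset.prod_cons, coeIdeal_mul]
    exact map_sup_mul_eq_one hA coeIdeal_le_one coeIdeal_le_one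
      (h I (Multiset.mem_cons_self I s)) (ih fun J hJ => h J (Multiset.mem_cons_of_mem hJ))

variable {σ} in
theorem map_sup_pow_eq_one {A B : FractionalIdeal R⁰ K} (hA : A ≤ 1) (hB : B ≤ 1)
    (h : σ (A ⊔ B) = 1) (n : ℕ) : σ (A ⊔ B ^ n) = 1 := by
  induction n with
  | zero => exact map_eq_one_of_le σ.map_one (by simp) (sup_le hA (by simp))
  | succ n ih =>
    rw [pow_succ]
    exact map_sup_mul_eq_one hA (pow_le_one' hB n) hB ih h

theorem starComaximal_iff {I J : Ideal R} : σ.StarComaximal I J ↔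
    σ ((I : FractionalIdeal R⁰ K) ⊔ (J : FractionalIdeal R⁰ K)) = 1 := by
  rw [StarComaximal, sup_eq_add, ← coeIdeal_sup]
  rfl

instance : Std.Symm σ.StarComaximal :=
  ⟨fun I J h => by rw [starComaximal_iff] at h ⊢; rwa [sup_comm]⟩

variable {σ} in
theorem StarComaximal.mono {I I' J J' : Ideal R} (h : σ.StarComaximal I J) (hI : I ≤ I')
    (hJ : J ≤ J') : σ.StarComaximal I' J' := by
  rw [starComaximal_iff] at h ⊢
  exact map_eq_one_of_le h (sup_le_sup ((coeIdeal_le_coeIdeal K).mpr hI)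
    ((coeIdeal_le_coeIdeal K).mpr hJ)) (sup_le coeIdeal_le_one coeIdeal_le_one)

variable {σ} in
theorem IsStarPrime.not_starComaximal {P I J : Ideal R} (hP : σ.IsStarPrime P) (hI : I ≤ P)
    (hJ : J ≤ P) : ¬ σ.StarComaximal I J := by
  intro h
  rw [starComaximal_iff] at h
  have h1 := map_le_of_isStarIdeal hP.2 (sup_le ((coeIdeal_le_coeIdeal K).mpr hI)
    ((coeIdeal_le_coeIdeal K).mpr hJ))
  rw [h] at h1
  exact hP.1.ne_top ((coeIdeal_eq_one.mp (le_antisymm coeIdeal_le_one h1)).trans Ideal.one_eq_top)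

/-- The integral ideal underlying `σ I`, for an integral ideal `I`. -/
theorem exists_coeIdeal_eq_map (I : Ideal R) :
    ∃ J : Ideal R, (J : FractionalIdeal R⁰ K) = σ (I : FractionalIdeal R⁰ K) :=
  le_one_iff_exists_coeIdeal.mp (map_le_one coeIdeal_le_one)

variable {σ} in
theorem isStarIdeal_of_eq_map {I J : Ideal R} (hJ : J ≠ ⊥)
    (h : (I : FractionalIdeal R⁰ K) = σ (J : FractionalIdeal R⁰ K)) : σ.IsStarIdeal I := by
  refine ⟨?_, by rw [h, map_map]⟩
  rintro rfl
  have := σ.le_map (J : FractionalIdeal R⁰ K)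
  rw [← h, coeIdeal_le_coeIdeal, le_bot_iff] at this
  exact hJ this

theorem isStarIdeal_span_singleton {y : R} (hy : y ≠ 0) : σ.IsStarIdeal (Ideal.span {y}) := by
  refine ⟨by simpa using hy, ?_⟩
  rw [coeIdeal_span_singleton]
  exact σ.map_spanSingleton (by simpa using hy)

theorem isStarInvertible_span_singleton {y : R} (hy : y ≠ 0) :
    σ.IsStarInvertible (Ideal.span {y}) := by
  refine ⟨by simpa using hy, ?_⟩
  rw [coe_ideal_span_singleton_mul_inv K hy, map_one]

variable {σ} in
/-- `σ`-invertible `σ`-primes are incomparable. -/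
theorem eq_of_le_of_isStarInvertible {P Q : Ideal R} (hP : σ.IsStarPrime P)
    (hQ : σ.IsStarPrime Q) (hP' : σ.IsStarInvertible P) (hQ' : σ.IsStarInvertible Q)
    (h : P ≤ Q) : P = Q := by
  by_contra hne
  have hQP : ¬ (Q : FractionalIdeal R⁰ K) ≤ P := fun h' =>
    hne (le_antisymm h ((coeIdeal_le_coeIdeal K).mp h'))
  have h1 : (P : FractionalIdeal R⁰ K) * (Q : FractionalIdeal R⁰ K)⁻¹ ≤ 1 :=
    (mul_le_mul' ((coeIdeal_le_coeIdeal K).mpr h) le_rfl).trans (mul_self_inv_le_one _)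
  have h2 : (Q : FractionalIdeal R⁰ K) * (P * (Q : FractionalIdeal R⁰ K)⁻¹) ≤ P := by
    rw [mul_left_comm]
    exact (mul_le_mul' le_rfl (mul_self_inv_le_one _)).trans (mul_one _).le
  -- Primality of `P` gives `PQ⁻¹ ⊆ P`. Multiplying by `P⁻¹` and closing gives `Q⁻¹ ⊆ R`, whence
  -- `QQ⁻¹ ⊆ Q`, against the σ-invertibility of `Q`.
  have h3 := ((mul_le_coeIdeal_iff hP.1 coeIdeal_le_one h1).mp h2).resolve_left hQP
  have h4 : (Q : FractionalIdeal R⁰ K)⁻¹ ≤ 1 := by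
    refine (σ.le_map _).trans ?_
    rw [← map_inv_mul_mul hP'.2, mul_left_comm]
    refine map_le_one ((mul_le_mul' le_rfl h3).trans ?_)
    rw [mul_comm]
    exact mul_self_inv_le_one _
  have h5 := map_le_of_isStarIdeal hQ.2 ((mul_le_mul' le_rfl h4).trans (mul_one _).le)
  rw [hQ'.2] at h5
  exact hQ.1.ne_top ((coeIdeal_eq_one.mp (le_antisymm coeIdeal_le_one h5)).trans Ideal.one_eq_top)

/-- A `σ`-invertible `σ`-prime that is `σ`-comaximal to every ideal that it does not contain. -/
structure IsInvertibleMaximal (P : Ideal R) : Prop where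
  isStarPrime : σ.IsStarPrime P
  isStarInvertible : σ.IsStarInvertible P
  starComaximal : ∀ I : Ideal R, ¬ I ≤ P → σ.StarComaximal P I

variable {σ} in
theorem IsInvertibleMaximal.eq_of_le {P Q : Ideal R} (hP : σ.IsInvertibleMaximal P)
    (hQ : σ.IsStarPrime Q) (h : P ≤ Q) : P = Q := by
  by_contra hne
  exact hQ.not_starComaximal h le_rfl
    (hP.starComaximal Q fun h' => hne (le_antisymm h h'))

/-- Every nonzero principal ideal is a `σ`-product of `σ`-invertible maximal `σ`-primes. -/
def HasPrimeFactorization : Prop :=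
  ∀ y : R, y ≠ 0 → ∃ s : Multiset (Ideal R), (∀ P ∈ s, σ.IsInvertibleMaximal P) ∧
    ((Ideal.span {y} : Ideal R) : FractionalIdeal R⁰ K) =
      σ ((s.prod : Ideal R) : FractionalIdeal R⁰ K)

end StarOperation

/-! ### Condition (i) is equivalent to prime factorization of principal ideals. -/

namespace StarOperation

open FractionalIdeal

variable {R K : Type*} [CommRing R] [IsDomain R] [Field K] [Algebra R K] [IsFractionRing R K]
  {σ : StarOperation R K}

theorem IsPacketFactorization.le {X : Ideal R} {s : Multiset (Ideal R)}
    (hs : σ.IsPacketFactorization X s) {I : Ideal R} (hI : I ∈ s) : X ≤ I := by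
  rw [← coeIdeal_le_coeIdeal K, hs.2.2]
  exact map_le_of_isStarIdeal (hs.1 I hI).1
    ((coeIdeal_le_coeIdeal K).mpr (Ideal.le_of_dvd (Multiset.dvd_prod hI)))

theorem exists_le_of_map_prod_le {X P : Ideal R} {s : Multiset (Ideal R)}
    (hs : (X : FractionalIdeal R⁰ K) = σ ((s.prod : Ideal R) : FractionalIdeal R⁰ K))
    (hP : P.IsPrime) (hX : X ≤ P) : ∃ I ∈ s, I ≤ P := by
  refine hP.multiset_prod_le.mp (le_trans ?_ hX)
  rw [← coeIdeal_le_coeIdeal K, hs]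
  exact σ.le_map _

theorem IsPacket.ne_top {I : Ideal R} (hI : σ.IsPacket I) : I ≠ ⊤ := by
  rintro rfl
  obtain ⟨P, hP, -⟩ := hI.2.2
  exact hP.1.1.ne_top (top_le_iff.mp hP.1.2)

theorem exists_map_prod_eq (s : Multiset (Ideal R))
    (h : ∀ I ∈ s, ∃ t : Multiset (Ideal R), (∀ P ∈ t, σ.IsInvertibleMaximal P) ∧
      σ (I : FractionalIdeal R⁰ K) = σ ((t.prod : Ideal R) : FractionalIdeal R⁰ K)) :
    ∃ t : Multiset (Ideal R), (∀ P ∈ t, σ.IsInvertibleMaximal P) ∧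
      σ ((s.prod : Ideal R) : FractionalIdeal R⁰ K) =
        σ ((t.prod : Ideal R) : FractionalIdeal R⁰ K) := by
  induction s using Multiset.induction with
  | empty => exact ⟨0, by simp, rfl⟩
  | cons I s ih =>
    obtain ⟨t, ht, e⟩ := ih fun J hJ => h J (Multiset.mem_cons_of_mem hJ)
    obtain ⟨t', ht', e'⟩ := h I (Multiset.mem_cons_self I s)
    refine ⟨t' + t, fun P hP => (Multiset.mem_add.mp hP).elim (ht' P) (ht P), ?_⟩
    rw [Multiset.prod_cons, Multiset.prod_add, coeIdeal_mul, coeIdeal_mul]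
    exact map_mul_congr e' e

/-- The `σ`-prime underlying a `σ`-invertible `σ`-power of it is `σ`-invertible. -/
theorem isStarInvertible_of_eq_map_pow {I P : Ideal R} {n : ℕ} (hI : σ.IsStarInvertible I)
    (hP : σ.IsStarPrime P) (hn : 1 ≤ n)
    (h : (I : FractionalIdeal R⁰ K) = σ ((P ^ n : Ideal R) : FractionalIdeal R⁰ K)) :
    σ.IsStarInvertible P := by
  refine ⟨hP.2.1, ?_⟩
  have h1 := hI.2
  obtain ⟨m, rfl⟩ := Nat.exists_eq_add_of_le hn
  rw [h, map_map_mul, add_comm, pow_succ', coeIdeal_mul, mul_assoc] at h1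
  exact map_mul_inv_eq_one h1

theorem le_of_eq_map_pow {I P : Ideal R} {n : ℕ} (hP : σ.IsStarPrime P) (hn : 1 ≤ n)
    (h : (I : FractionalIdeal R⁰ K) = σ ((P ^ n : Ideal R) : FractionalIdeal R⁰ K)) : I ≤ P := by
  rw [← coeIdeal_le_coeIdeal K, h]
  exact map_le_of_isStarIdeal hP.2
    ((coeIdeal_le_coeIdeal K).mpr (Ideal.pow_le_self (by lia)))

theorem pow_le_of_eq_map_pow {I P : Ideal R} {n : ℕ}
    (h : (I : FractionalIdeal R⁰ K) = σ ((P ^ n : Ideal R) : FractionalIdeal R⁰ K)) :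
    P ^ n ≤ I := by
  rw [← coeIdeal_le_coeIdeal K, h]
  exact σ.le_map _

theorem isStarIdeal_isStarInvertible_of_eq_map {X A : Ideal R} (hA0 : A ≠ ⊥)
    (hA : σ ((A : FractionalIdeal R⁰ K) * (A : FractionalIdeal R⁰ K)⁻¹) = 1)
    (h : (X : FractionalIdeal R⁰ K) = σ (A : FractionalIdeal R⁰ K)) :
    σ.IsStarIdeal X ∧ σ.IsStarInvertible X := by
  have h1 := isStarIdeal_of_eq_map hA0 h
  exact ⟨h1, h1.1, map_mul_inv_congr (h ▸ (σ.map_map _).symm) hA⟩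

section URD

variable (hU : σ.IsURD) (hP : ∀ I : Ideal R, σ.IsPacket I → σ.IsStarPowerOfStarPrime I)
include hU hP

theorem starComaximal_of_isURD {P Q : Ideal R} (hPp : σ.IsStarPrime P) (hQp : σ.IsStarPrime Q)
    (hPi : σ.IsStarInvertible P) (hQi : σ.IsStarInvertible Q) (hne : P ≠ Q) :
    σ.StarComaximal P Q := by
  obtain ⟨X, hX⟩ := σ.exists_coeIdeal_eq_map (P * Q)
  have hX' := isStarIdeal_isStarInvertible_of_eq_map (mul_ne_zero hPp.2.1 hQp.2.1)
    (by rw [coeIdeal_mul]; exact map_mul_mul_inv_eq_one hPi.2 hQi.2) hX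
  have hPQX : P * Q ≤ X := by
    rw [← coeIdeal_le_coeIdeal K, hX]
    exact σ.le_map _
  have hXP : X ≤ P := by
    rw [← coeIdeal_le_coeIdeal K, hX]
    exact map_le_of_isStarIdeal hPp.2 ((coeIdeal_le_coeIdeal K).mpr Ideal.mul_le_left)
  have hXQ : X ≤ Q := by
    rw [← coeIdeal_le_coeIdeal K, hX]
    exact map_le_of_isStarIdeal hQp.2 ((coeIdeal_le_coeIdeal K).mpr Ideal.mul_le_right)
  have hXtop : X ≠ ⊤ := fun h => hPp.1.ne_top (top_le_iff.mp (h ▸ hXP))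
  obtain ⟨s, hs, -⟩ := hU X hXtop hX'.1 hX'.2
  obtain ⟨I, hI, hIP⟩ := exists_le_of_map_prod_le hs.2.2 hPp.1 hXP
  obtain ⟨J, hJ, hJQ⟩ := exists_le_of_map_prod_le hs.2.2 hQp.1 hXQ
  -- If a single packet lies under both `P` and `Q`, its prime `T` lies in both and contains `PQ`,
  -- hence contains `P` or `Q`; so one of `P`, `Q` lies in the other. If there are two packets,
  -- their comaximality passes up to `P` and `Q`.
  by_cases hIJ : I = J
  · subst hIJ
    obtain ⟨T, n, hT, hn, hIT⟩ := hP I (hs.1 I hI)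
    have hTP : T ≤ P := hPp.1.le_of_pow_le ((pow_le_of_eq_map_pow hIT).trans hIP)
    have hTQ : T ≤ Q := hQp.1.le_of_pow_le ((pow_le_of_eq_map_pow hIT).trans hJQ)
    rcases hT.1.mul_le.mp ((hPQX.trans (hs.le hI)).trans (le_of_eq_map_pow hT hn hIT)) with h | h
    · exact absurd (eq_of_le_of_isStarInvertible hPp hQp hPi hQi (h.trans hTQ)) hne
    · exact absurd (eq_of_le_of_isStarInvertible hQp hPp hQi hPi (h.trans hTP)).symm hne
  · exact (hs.2.1.forall hI hJ hIJ).mono hIP hJQ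

theorem isInvertibleMaximal_of_isURD {P : Ideal R} (hPp : σ.IsStarPrime P)
    (hPi : σ.IsStarInvertible P) : σ.IsInvertibleMaximal P := by
  refine ⟨hPp, hPi, fun I hI => ?_⟩
  -- It suffices to treat `(x)`: its packets are σ-powers of primes containing `x`, which therefore
  -- differ from `P` and are σ-comaximal to it.
  obtain ⟨x, hxI, hxP⟩ := Set.not_subset.mp hI
  have hx0 : x ≠ 0 := fun h => hxP (h ▸ P.zero_mem)
  refine StarComaximal.mono (J := Ideal.span {x}) ?_ le_rfl
    ((Ideal.span_singleton_le_iff_mem I).mpr hxI)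
  rw [starComaximal_iff]
  by_cases hu : Ideal.span {x} = ⊤
  · rw [hu, coeIdeal_top]
    exact map_eq_one_of_le σ.map_one le_sup_right (sup_le coeIdeal_le_one le_rfl)
  obtain ⟨s, hs, -⟩ := hU _ hu (σ.isStarIdeal_span_singleton hx0)
    (σ.isStarInvertible_span_singleton hx0)
  rw [hs.2.2, map_sup_map]
  refine map_sup_prod_eq_one coeIdeal_le_one s fun J hJ => ?_
  obtain ⟨Q, n, hQ, hn, hJQ⟩ := hP J (hs.1 J hJ)
  rw [hJQ, map_sup_map, coeIdeal_pow]
  refine map_sup_pow_eq_one coeIdeal_le_one coeIdeal_le_one ?_ n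
  rw [← starComaximal_iff]
  refine starComaximal_of_isURD hU hP hPp hQ hPi
    (isStarInvertible_of_eq_map_pow (hs.1 J hJ).2.1 hQ hn hJQ) ?_
  rintro rfl
  exact hxP (le_of_eq_map_pow hQ hn hJQ (hs.le hJ (Ideal.mem_span_singleton_self x)))

theorem hasPrimeFactorization_of_isURD : σ.HasPrimeFactorization := by
  intro y hy
  by_cases hu : Ideal.span {y} = ⊤
  · refine ⟨0, by simp, ?_⟩
    simp [hu, σ.map_one]
  obtain ⟨s, hs, -⟩ := hU _ hu (σ.isStarIdeal_span_singleton hy)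
    (σ.isStarInvertible_span_singleton hy)
  rw [hs.2.2]
  refine exists_map_prod_eq s fun J hJ => ?_
  obtain ⟨Q, n, hQ, hn, hJQ⟩ := hP J (hs.1 J hJ)
  refine ⟨Multiset.replicate n Q, fun P hPm => ?_, ?_⟩
  · rw [Multiset.eq_of_mem_replicate hPm]
    exact isInvertibleMaximal_of_isURD hU hP hQ
      (isStarInvertible_of_eq_map_pow (hs.1 J hJ).2.1 hQ hn hJQ)
  · rw [hJQ, map_map, Multiset.prod_replicate]

end URD

/-- The σ-version of "a divisor of a product of primes is a product of some of them": a prime `P ∈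
s` contains `AB`, hence `A` or `B`. That factor is replaced by its product with `P⁻¹`, which is
still integral, and `P` is cancelled. -/
theorem exists_map_eq_of_map_mul_eq (s : Multiset (Ideal R))
    (hs : ∀ P ∈ s, σ.IsInvertibleMaximal P) {A B : FractionalIdeal R⁰ K} (hA : A ≤ 1) (hB : B ≤ 1)
    (h : σ (A * B) = σ ((s.prod : Ideal R) : FractionalIdeal R⁰ K)) :
    ∃ t : Multiset (Ideal R), (∀ P ∈ t, σ.IsInvertibleMaximal P) ∧
      σ A = σ ((t.prod : Ideal R) : FractionalIdeal R⁰ K) := by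
  induction s using Multiset.induction generalizing A B with
  | empty =>
    refine ⟨0, by simp, ?_⟩
    simp only [Multiset.prod_zero, Ideal.one_eq_top, coeIdeal_top, map_one] at h ⊢
    exact map_eq_one_of_le h ((mul_le_mul' le_rfl hB).trans (mul_one A).le) hA
  | cons P s ih =>
    have hPm := hs P (Multiset.mem_cons_self P s)
    have hPi := hPm.isStarInvertible.2
    have ih' := @ih fun Q hQ => hs Q (Multiset.mem_cons_of_mem hQ)
    rw [Multiset.prod_cons, coeIdeal_mul] at h
    have hle : ∀ {C : FractionalIdeal R⁰ K}, C ≤ P →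
        (P : FractionalIdeal R⁰ K)⁻¹ * C ≤ 1 := fun hC => by
      rw [mul_comm]
      exact (mul_le_mul' hC le_rfl).trans (mul_self_inv_le_one _)
    have hAB : A * B ≤ P := (σ.le_map _).trans (h.le.trans (map_le_of_isStarIdeal
      hPm.isStarPrime.2 ((mul_le_mul' le_rfl coeIdeal_le_one).trans (mul_one _).le)))
    have hcancel : σ ((P : FractionalIdeal R⁰ K)⁻¹ * (A * B)) =
        σ ((s.prod : Ideal R) : FractionalIdeal R⁰ K) := by
      refine map_mul_cancel hPi ?_
      rw [map_inv_mul_mul hPi, h]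
    rcases (mul_le_coeIdeal_iff hPm.isStarPrime.1 hA hB).mp hAB with hA' | hB'
    · obtain ⟨t, ht, e⟩ := ih' (hle hA') hB (by rw [mul_assoc, hcancel])
      refine ⟨P ::ₘ t, fun Q hQ => ?_, ?_⟩
      · rcases Multiset.mem_cons.mp hQ with rfl | hQ
        exacts [hPm, ht Q hQ]
      · rw [Multiset.prod_cons, coeIdeal_mul, ← map_inv_mul_mul hPi A]
        exact map_mul_congr rfl e
    · exact ih' hA (hle hB') (by rw [mul_left_comm, hcancel])

theorem HasPrimeFactorization.exists_multiset (h : σ.HasPrimeFactorization) {X : Ideal R}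
    (hX : σ.IsStarInvertible X) : ∃ t : Multiset (Ideal R),
      (∀ P ∈ t, σ.IsInvertibleMaximal P) ∧
      σ (X : FractionalIdeal R⁰ K) = σ ((t.prod : Ideal R) : FractionalIdeal R⁰ K) := by
  obtain ⟨y, hyX, hy⟩ := Submodule.exists_mem_ne_zero_of_ne_bot hX.1
  obtain ⟨s, hs, e⟩ := h y hy
  -- For nonzero `y ∈ X`, the ideal `X` σ-divides `(y)` with integral cofactor `X⁻¹y`.
  refine exists_map_eq_of_map_mul_eq s hs coeIdeal_le_one
    (B := (X : FractionalIdeal R⁰ K)⁻¹ * ((Ideal.span {y} : Ideal R) : FractionalIdeal R⁰ K)) ?_ ?_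
  · rw [mul_comm]
    refine (mul_le_mul' ?_ le_rfl).trans (mul_self_inv_le_one _)
    exact (coeIdeal_le_coeIdeal K).mpr ((Ideal.span_singleton_le_iff_mem X).mpr hyX)
  · rw [map_inv_mul_mul hX.2, e, map_map]

theorem IsInvertibleMaximal.isPacket {P I : Ideal R} (hP : σ.IsInvertibleMaximal P) {n : ℕ}
    (hn : 1 ≤ n)
    (h : (I : FractionalIdeal R⁰ K) = σ ((P ^ n : Ideal R) : FractionalIdeal R⁰ K)) :
    σ.IsPacket I := by
  have h1 := isStarIdeal_isStarInvertible_of_eq_map (pow_ne_zero n hP.isStarPrime.2.1)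
    (by rw [coeIdeal_pow]; exact map_pow_mul_inv_eq_one hP.isStarInvertible.2 n) h
  have hle : ∀ Q : Ideal R, Q.IsPrime → I ≤ Q → P ≤ Q := fun Q hQ hIQ =>
    hQ.le_of_pow_le ((pow_le_of_eq_map_pow h).trans hIQ)
  have hIP := le_of_eq_map_pow hP.isStarPrime hn h
  refine ⟨h1.1, h1.2, P, ⟨⟨hP.isStarPrime.1, hIP⟩, fun Q hQ _ => hle Q hQ.1 hQ.2⟩, ?_⟩
  exact fun Q hQ => le_antisymm (hQ.2 ⟨hP.isStarPrime.1, hIP⟩ (hle Q hQ.1.1 hQ.1.2))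
    (hle Q hQ.1.1 hQ.1.2)

theorem HasPrimeFactorization.exists_eq_map_pow (h : σ.HasPrimeFactorization) {I : Ideal R}
    (hI : σ.IsPacket I) : ∃ (P : Ideal R) (n : ℕ), σ.IsInvertibleMaximal P ∧ 1 ≤ n ∧
      (I : FractionalIdeal R⁰ K) = σ ((P ^ n : Ideal R) : FractionalIdeal R⁰ K) := by
  obtain ⟨t, ht, e⟩ := h.exists_multiset hI.2.1
  rw [hI.1.2] at e
  obtain ⟨P, hP, huniq⟩ := hI.2.2
  -- Each prime `Q` of the factorization is minimal over `I`: a prime between `I` and `Q` contains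
  -- some `Q' ∈ t`, and `Q' ⊆ Q` forces `Q' = Q`. A packet has only one minimal prime.
  have key : ∀ Q ∈ t, Q = P := fun Q hQ => by
    refine huniq Q ⟨⟨(ht Q hQ).isStarPrime.1, ?_⟩, fun T hT hTQ => ?_⟩
    · rw [← coeIdeal_le_coeIdeal K, e]
      exact map_le_of_isStarIdeal (ht Q hQ).isStarPrime.2
        ((coeIdeal_le_coeIdeal K).mpr (Ideal.le_of_dvd (Multiset.dvd_prod hQ)))
    · obtain ⟨Q', hQ', hle⟩ := exists_le_of_map_prod_le e hT.1 hT.2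
      rwa [← (ht Q' hQ').eq_of_le (ht Q hQ).isStarPrime (hle.trans hTQ)]
  obtain ⟨Q, hQ, -⟩ := exists_le_of_map_prod_le e hP.1.1 hP.1.2
  refine ⟨P, Multiset.card t, key Q hQ ▸ ht Q hQ,
    Multiset.card_pos_iff_exists_mem.mpr ⟨Q, hQ⟩, ?_⟩
  rw [e, Multiset.eq_replicate_card.mpr key, Multiset.prod_replicate, Multiset.card_replicate]

/-- If `n > m`, cancelling `P ^ m` leaves a factor `P` on the right, putting `A` inside `P`. Applied
in both directions, it makes the exponent of `P` well defined. -/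
theorem IsInvertibleMaximal.le_of_map_pow_mul_eq {P : Ideal R} (hP : σ.IsInvertibleMaximal P)
    {m n : ℕ} {A B : FractionalIdeal R⁰ K} (hB : B ≤ 1) (hA : ¬ A ≤ P)
    (h : σ ((P : FractionalIdeal R⁰ K) ^ m * A) = σ ((P : FractionalIdeal R⁰ K) ^ n * B)) :
    n ≤ m := by
  by_contra! hlt
  obtain ⟨k, rfl⟩ := Nat.exists_eq_add_of_lt hlt
  rw [add_assoc, pow_add, mul_assoc] at h
  have h1 := map_mul_cancel (map_pow_mul_inv_eq_one hP.isStarInvertible.2 m) h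
  refine hA ((σ.le_map _).trans (h1.le.trans (map_le_of_isStarIdeal hP.isStarPrime.2 ?_)))
  rw [pow_succ']
  refine (mul_le_mul' (mul_le_mul' le_rfl (pow_le_one' coeIdeal_le_one k)) hB).trans ?_
  rw [mul_one, mul_one]

theorem IsPacketFactorization.nodup {X : Ideal R} {s : Multiset (Ideal R)}
    (hs : σ.IsPacketFactorization X s) : s.Nodup := by
  rw [Multiset.nodup_iff_pairwise]
  obtain ⟨l, rfl, hl⟩ := hs.2.1
  -- A repeated packet would be σ-comaximal to itself, hence equal to `R`, but packets are proper.
  refine ⟨l, rfl, hl.imp_of_mem fun {I J} hI _ hIJ hne => ?_⟩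
  subst hne
  have hI' := hs.1 I hI
  rw [starComaximal_iff, sup_idem, hI'.1.2] at hIJ
  exact hI'.ne_top ((coeIdeal_eq_one.mp hIJ).trans Ideal.one_eq_top)

/-- The part of a packet factorization away from a packet belonging to the prime `P`. -/
theorem IsPacketFactorization.exists_eq_map_mul {X : Ideal R} {s : Multiset (Ideal R)}
    (hs : σ.IsPacketFactorization X s) {I P : Ideal R} (hI : I ∈ s) (hP : σ.IsStarPrime P)
    (hIP : I ≤ P) : ∃ A : Ideal R, ¬ A ≤ P ∧
      (X : FractionalIdeal R⁰ K) = σ ((I : FractionalIdeal R⁰ K) * (A : FractionalIdeal R⁰ K)) := by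
  obtain ⟨u, rfl⟩ := Multiset.exists_cons_of_mem hI
  refine ⟨u.prod, fun hle => ?_, by rw [hs.2.2, Multiset.prod_cons, coeIdeal_mul]⟩
  obtain ⟨J, hJ, hJP⟩ := hP.1.multiset_prod_le.mp hle
  have hne : I ≠ J := by
    rintro rfl
    exact (Multiset.nodup_cons.mp hs.nodup).1 hJ
  exact hP.not_starComaximal hIP hJP (hs.2.1.forall hI (Multiset.mem_cons_of_mem hJ) hne)

/-- The prime `P` of `I` contains `X`, so some packet of `s'` also belongs to `P`. In both
factorizations the remaining factors multiply to an ideal outside `P`, so the two exponents of `P`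
agree. As factorizations have no repetitions, membership is all that uniqueness requires. -/
theorem HasPrimeFactorization.mem_of_mem (h : σ.HasPrimeFactorization) {X : Ideal R}
    {s s' : Multiset (Ideal R)} (hs : σ.IsPacketFactorization X s)
    (hs' : σ.IsPacketFactorization X s') {I : Ideal R} (hI : I ∈ s) : I ∈ s' := by
  obtain ⟨P, n, hP, hn, e⟩ := h.exists_eq_map_pow (hs.1 I hI)
  have hIP := le_of_eq_map_pow hP.isStarPrime hn e
  obtain ⟨J, hJ, hJP⟩ := exists_le_of_map_prod_le hs'.2.2 hP.isStarPrime.1 ((hs.le hI).trans hIP)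
  obtain ⟨Q, m, hQ, hm, e'⟩ := h.exists_eq_map_pow (hs'.1 J hJ)
  obtain rfl : Q = P := hQ.eq_of_le hP.isStarPrime
    (hP.isStarPrime.1.le_of_pow_le ((pow_le_of_eq_map_pow e').trans hJP))
  obtain ⟨A, hA, hXA⟩ := hs.exists_eq_map_mul hI hP.isStarPrime hIP
  obtain ⟨B, hB, hXB⟩ := hs'.exists_eq_map_mul hJ hP.isStarPrime hJP
  rw [← coeIdeal_le_coeIdeal K] at hA hB
  rw [e, map_map_mul, coeIdeal_pow] at hXA
  rw [e', map_map_mul, coeIdeal_pow, hXA] at hXB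
  obtain rfl : n = m := le_antisymm (hP.le_of_map_pow_mul_eq coeIdeal_le_one hB hXB.symm)
    (hP.le_of_map_pow_mul_eq coeIdeal_le_one hA hXB)
  rwa [coeIdeal_inj.mp (e.trans e'.symm)]

theorem exists_isPacketFactorization {X : Ideal R} (hX : σ.IsStarIdeal X)
    {t : Multiset (Ideal R)} (ht : ∀ P ∈ t, σ.IsInvertibleMaximal P)
    (e : σ (X : FractionalIdeal R⁰ K) = σ ((t.prod : Ideal R) : FractionalIdeal R⁰ K)) :
    ∃ s : Multiset (Ideal R), σ.IsPacketFactorization X s := by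
  classical
  choose f hf using fun P : Ideal R => σ.exists_coeIdeal_eq_map (P ^ t.count P)
  have hle : ∀ P ∈ t, f P ≤ P := fun P hP => le_of_eq_map_pow (ht P hP).isStarPrime
    (Multiset.one_le_count_iff_mem.mpr hP) (hf P)
  -- One packet `(P ^ count)^σ` for each distinct prime of `t`.
  refine ⟨t.toFinset.val.map f, ?_, ?_, ?_⟩
  · intro I hI
    obtain ⟨P, hP, rfl⟩ := Multiset.mem_map.mp hI
    have hP' : P ∈ t := Multiset.mem_toFinset.mp hP
    exact (ht P hP').isPacket (Multiset.one_le_count_iff_mem.mpr hP') (hf P)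
  · have hco : ∀ P ∈ t, ∀ Q ∈ t, P ≠ Q → σ.StarComaximal (f P) (f Q) := by
      intro P hP Q hQ hne
      have hPQ := (ht P hP).starComaximal Q fun hle =>
        hne ((ht Q hQ).eq_of_le (ht P hP).isStarPrime hle).symm
      rw [starComaximal_iff] at hPQ ⊢
      rw [hf Q, map_sup_map, coeIdeal_pow]
      refine map_sup_pow_eq_one coeIdeal_le_one coeIdeal_le_one ?_ _
      rw [sup_comm, hf P, map_sup_map, coeIdeal_pow]
      refine map_sup_pow_eq_one coeIdeal_le_one coeIdeal_le_one ?_ _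
      rwa [sup_comm]
    refine Multiset.Nodup.pairwise (fun I hI J hJ hne => ?_) (Multiset.Nodup.map_on ?_
      t.toFinset.nodup)
    · obtain ⟨P, hP, rfl⟩ := Multiset.mem_map.mp hI
      obtain ⟨Q, hQ, rfl⟩ := Multiset.mem_map.mp hJ
      exact hco P (Multiset.mem_toFinset.mp hP) Q (Multiset.mem_toFinset.mp hQ)
        fun h => hne (h ▸ rfl)
    -- Distinct primes give distinct packets: a common value would be σ-comaximal to itself while
    -- lying in the σ-prime `P`.
    · intro P hP Q hQ hPQ
      by_contra hne
      have hP' : P ∈ t := Multiset.mem_toFinset.mp hP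
      exact (ht P hP').isStarPrime.not_starComaximal (hle P hP') (hPQ ▸ hle P hP')
        (hco P hP' Q (Multiset.mem_toFinset.mp hQ) hne)
  · have key : ∀ u : Finset (Ideal R), σ ((∏ P ∈ u, f P : Ideal R) : FractionalIdeal R⁰ K) =
        σ ((∏ P ∈ u, P ^ t.count P : Ideal R) : FractionalIdeal R⁰ K) := by
      intro u
      induction u using Finset.induction_on with
      | empty => simp
      | insert P u hPu ih =>
        rw [Finset.prod_insert hPu, Finset.prod_insert hPu, coeIdeal_mul, coeIdeal_mul]
        exact map_mul_congr (by rw [hf, map_map]) ih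
    rw [← hX.2, e, Finset.prod_multiset_count t]
    exact (key _).symm

theorem HasPrimeFactorization.isURD (h : σ.HasPrimeFactorization) : σ.IsURD := by
  intro X _ hX hXi
  obtain ⟨t, ht, e⟩ := h.exists_multiset hXi
  obtain ⟨s, hs⟩ := exists_isPacketFactorization hX ht e
  exact ⟨s, hs, fun s' hs' => (Multiset.Nodup.ext hs'.nodup hs.nodup).mpr fun I =>
    ⟨h.mem_of_mem hs' hs, h.mem_of_mem hs hs'⟩⟩

theorem isURD_and_packets_iff_hasPrimeFactorization :
    (σ.IsURD ∧ ∀ I : Ideal R, σ.IsPacket I → σ.IsStarPowerOfStarPrime I) ↔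
      σ.HasPrimeFactorization := by
  refine ⟨fun h => hasPrimeFactorization_of_isURD h.1 h.2, fun h => ⟨h.isURD, fun I hI => ?_⟩⟩
  obtain ⟨P, n, hP, hn, e⟩ := h.exists_eq_map_pow hI
  exact ⟨P, n, hP.isStarPrime, hn, e⟩

end StarOperation

/-! ### Uniformizers and local generators, with denominators cleared so that they live in `R`. -/

section Uniformizer

variable {R : Type*} [CommRing R] [IsDomain R]

/-- The image of `π` in `R_P` generates all nonzero principal ideals of `R_P` by its powers. -/
structure IsUniformizerAt (P : Ideal R) (π : R) : Prop where
  mem : π ∈ P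
  exists_eq : ∀ y : R, y ≠ 0 → ∃ (n : ℕ) (u w : R), u ∉ P ∧ w ∉ P ∧ u * y = w * π ^ n

namespace IsUniformizerAt

variable {P : Ideal R} {π : R}

theorem dvd_of_mem (h : IsUniformizerAt P π) (hP : P.IsPrime) {y : R} (hy : y ∈ P) :
    ∃ u, u ∉ P ∧ π ∣ u * y := by
  by_cases h0 : y = 0
  · exact ⟨1, fun h1 => hP.ne_top ((Ideal.eq_top_iff_one P).mpr h1), by simp [h0]⟩
  obtain ⟨n, u, w, hu, hw, e⟩ := h.exists_eq y h0
  refine ⟨u, hu, ?_⟩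
  cases n with
  -- Exponent `0` would mean `w = u * y ∈ P`.
  | zero => exact absurd (by simpa [e] using P.mul_mem_left u hy) hw
  | succ n => rw [e, pow_succ]; exact ⟨w * π ^ n, by ring⟩

theorem ne_zero (h : IsUniformizerAt P π) (hP : P.IsPrime) (h0 : P ≠ ⊥) : π ≠ 0 := by
  rintro rfl
  obtain ⟨y, hy, hy0⟩ := Submodule.exists_mem_ne_zero_of_ne_bot h0
  obtain ⟨u, hu, hd⟩ := h.dvd_of_mem hP hy
  rw [zero_dvd_iff, mul_eq_zero] at hd
  exact hd.elim (fun h => hu (h ▸ P.zero_mem)) hy0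

/-- An element of `I` of least order at `P` generates `I` locally at `P`. -/
theorem exists_local_generator (h : IsUniformizerAt P π) (hP : P.IsPrime) {I : Ideal R}
    (hI : I ≠ ⊥) : ∃ y ∈ I, y ≠ 0 ∧ ∀ z ∈ I, ∃ u, u ∉ P ∧ y ∣ u * z := by
  classical
  have hex : ∃ n : ℕ, ∃ y ∈ I, y ≠ 0 ∧ ∃ u w, u ∉ P ∧ w ∉ P ∧ u * y = w * π ^ n := by
    obtain ⟨y, hy, hy0⟩ := Submodule.exists_mem_ne_zero_of_ne_bot hI
    obtain ⟨n, u, w, h'⟩ := h.exists_eq y hy0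
    exact ⟨n, y, hy, hy0, u, w, h'⟩
  obtain ⟨y, hy, hy0, u, w, hu, hw, e⟩ := Nat.find_spec hex
  refine ⟨y, hy, hy0, fun z hz => ?_⟩
  by_cases hz0 : z = 0
  · exact ⟨1, fun h1 => hP.ne_top ((Ideal.eq_top_iff_one P).mpr h1), by simp [hz0]⟩
  obtain ⟨m, u', w', hu', hw', e'⟩ := h.exists_eq z hz0
  have hle : Nat.find hex ≤ m := Nat.find_min' hex ⟨z, hz, hz0, u', w', hu', hw', e'⟩
  obtain ⟨k, hk⟩ := Nat.exists_eq_add_of_le hle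
  refine ⟨w * u', hP.mul_notMem hw hu', u * w' * π ^ k, ?_⟩
  rw [hk, pow_add] at e'
  linear_combination w * e' - w' * π ^ k * e

theorem isDiscreteValuationRing [hP : P.IsPrime] (h : IsUniformizerAt P π) (h0 : P ≠ ⊥) :
    IsDiscreteValuationRing (Localization.AtPrime P) := by
  have hunit : ∀ u : R, u ∉ P → IsUnit (algebraMap R (Localization.AtPrime P) u) := fun u hu =>
    IsLocalization.map_units _ (⟨u, hu⟩ : P.primeCompl)
  have hinj : Function.Injective (algebraMap R (Localization.AtPrime P)) :=
    IsLocalization.injective _ P.primeCompl_le_nonZeroDivisors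
  have key : ∀ {x : Localization.AtPrime P}, x ≠ 0 →
      ∃ n : ℕ, Associated (algebraMap R (Localization.AtPrime P) π ^ n) x := by
    intro x hx
    obtain ⟨y, s, rfl⟩ := IsLocalization.exists_mk'_eq P.primeCompl x
    have hy : y ≠ 0 := by
      rintro rfl
      exact hx (IsLocalization.mk'_zero s)
    obtain ⟨n, u, w, hu, hw, e⟩ := h.exists_eq y hy
    refine ⟨n, ?_⟩
    have e2 : algebraMap R (Localization.AtPrime P) π ^ n * algebraMap R _ w =
        IsLocalization.mk' (Localization.AtPrime P) y s * (algebraMap R _ s * algebraMap R _ u) := by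
      rw [← mul_assoc, IsLocalization.mk'_spec, ← map_pow, ← map_mul, ← map_mul]
      congr 1
      linear_combination -e
    have h1 := associated_mul_unit_right (algebraMap R (Localization.AtPrime P) π ^ n) _
      (hunit w hw)
    rw [e2] at h1
    exact h1.trans (associated_mul_unit_left _ _ ((hunit s s.2).mul (hunit u hu)))
  refine IsDiscreteValuationRing.ofHasUnitMulPowIrreducibleFactorization ⟨_, ?_, key⟩
  refine IsDiscreteValuationRing.irreducible_of_span_eq_maximalIdeal _ ?_ ?_
  · exact fun hz => h.ne_zero hP h0 (hinj (by rw [hz, map_zero]))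
  · have hmem : algebraMap R (Localization.AtPrime P) π ∈
        IsLocalRing.maximalIdeal (Localization.AtPrime P) :=
      (IsLocalization.AtPrime.to_map_mem_maximal_iff _ P π).mpr h.mem
    refine le_antisymm (fun x hx => ?_) ((Ideal.span_singleton_le_iff_mem _).mpr hmem)
    by_cases hx0 : x = 0
    · rw [hx0]; exact Submodule.zero_mem _
    obtain ⟨n, hn⟩ := key hx0
    rw [Ideal.mem_span_singleton]
    refine dvd_trans (dvd_pow_self _ ?_) hn.dvd
    rintro rfl
    rw [pow_zero] at hn
    exact (IsLocalRing.mem_maximalIdeal _).mp hx (hn.isUnit isUnit_one)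

end IsUniformizerAt

theorem exists_isUniformizerAt (P : Ideal R) [hP : P.IsPrime]
    [IsDiscreteValuationRing (Localization.AtPrime P)] : ∃ π : R, IsUniformizerAt P π := by
  have hunit : ∀ u : R, IsUnit (algebraMap R (Localization.AtPrime P) u) ↔ u ∉ P := fun u =>
    IsLocalization.AtPrime.isUnit_to_map_iff _ P u
  have hinj : Function.Injective (algebraMap R (Localization.AtPrime P)) :=
    IsLocalization.injective _ P.primeCompl_le_nonZeroDivisors
  obtain ⟨ϖ, hϖ⟩ := IsDiscreteValuationRing.exists_irreducible (Localization.AtPrime P)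
  obtain ⟨π, s, rfl⟩ := IsLocalization.exists_mk'_eq P.primeCompl ϖ
  -- The numerator of an irreducible fraction is associated to it, as the denominator is a unit of
  -- `R_P`; so the uniformizer may be taken in `R`.
  have hπ : Irreducible (algebraMap R (Localization.AtPrime P) π) := by
    refine Associated.irreducible ?_ hϖ
    rw [← IsLocalization.mk'_spec (Localization.AtPrime P) π s]
    exact associated_mul_unit_right _ _ ((hunit s).mpr s.2)
  refine ⟨π, not_not.mp fun h => hπ.not_isUnit ((hunit π).mpr h), fun y hy => ?_⟩
  obtain ⟨n, v, e⟩ := IsDiscreteValuationRing.eq_unit_mul_pow_irreducible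
    (x := algebraMap R (Localization.AtPrime P) y)
    (fun h => hy (hinj (by rw [h, map_zero]))) hπ
  obtain ⟨w, u, hwu⟩ := IsLocalization.exists_mk'_eq P.primeCompl (v : Localization.AtPrime P)
  have e1 := IsLocalization.mk'_spec (Localization.AtPrime P) w u
  rw [hwu] at e1
  refine ⟨n, u, w, u.2, (hunit w).mp (e1 ▸ v.isUnit.mul ((hunit u).mpr u.2)), hinj ?_⟩
  rw [map_mul, map_mul, map_pow, e, ← e1]
  ring

/-- The denominators needed for finitely many generators are multiplied together; their product
avoids `P` because `P` is prime. -/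
theorem exists_forall_dvd_of_fg {P : Ideal R} (hP : P.IsPrime) {I : Ideal R} (hI : I.FG) {y : R}
    (h : ∀ z ∈ I, ∃ u, u ∉ P ∧ y ∣ u * z) : ∃ u, u ∉ P ∧ ∀ z ∈ I, y ∣ u * z := by
  induction I, hI using Submodule.fg_induction with
  | singleton x =>
    obtain ⟨u, hu, hd⟩ := h x (Submodule.mem_span_singleton_self x)
    refine ⟨u, hu, fun z hz => ?_⟩
    obtain ⟨r, rfl⟩ := Submodule.mem_span_singleton.mp hz
    rw [smul_eq_mul, mul_left_comm]
    exact hd.mul_left r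
  | sup I J _ _ hI hJ =>
    obtain ⟨u, hu, hud⟩ := hI fun z hz => h z (Ideal.mem_sup_left hz)
    obtain ⟨v, hv, hvd⟩ := hJ fun z hz => h z (Ideal.mem_sup_right hz)
    refine ⟨u * v, hP.mul_notMem hu hv, fun z hz => ?_⟩
    obtain ⟨a, ha, b, hb, rfl⟩ := Submodule.mem_sup.mp hz
    rw [mul_add]
    refine dvd_add ?_ ?_
    · rw [mul_comm u, mul_assoc]; exact (hud a ha).mul_left v
    · rw [mul_assoc]; exact (hvd b hb).mul_left u

theorem not_mul_inv_le_of_fg {K : Type*} [Field K] [Algebra R K] [IsFractionRing R K]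
    {P : Ideal R} (hP : P.IsPrime) {J : Ideal R} (hJ : J.FG) {y : R} (hy : y ∈ J) (hy0 : y ≠ 0)
    (h : ∀ z ∈ J, ∃ u, u ∉ P ∧ y ∣ u * z) :
    ¬ (J : FractionalIdeal R⁰ K) * (J : FractionalIdeal R⁰ K)⁻¹ ≤ P := by
  obtain ⟨u, hu, hd⟩ := exists_forall_dvd_of_fg hP hJ h
  have hJ0 : (J : FractionalIdeal R⁰ K) ≠ 0 := by
    rw [FractionalIdeal.coeIdeal_ne_zero]
    rintro rfl
    exact hy0 hy
  have hyK : algebraMap R K y ≠ 0 := by simpa using hy0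
  -- With a common denominator `u`, the fraction `u / y` lies in `J⁻¹`, and its product with `y ∈ J`
  -- is `u ∉ P`.
  have hc : algebraMap R K u / algebraMap R K y ∈ (J : FractionalIdeal R⁰ K)⁻¹ := by
    rw [FractionalIdeal.mem_inv_iff hJ0]
    intro z hz
    obtain ⟨x, hx, rfl⟩ := (FractionalIdeal.mem_coeIdeal _).mp hz
    obtain ⟨r, hr⟩ := hd x hx
    refine (FractionalIdeal.mem_one_iff _).mpr ⟨r, ?_⟩
    rw [div_mul_eq_mul_div, ← map_mul, hr, map_mul, mul_div_cancel_left₀ _ hyK]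
  intro hle
  have hm := hle (FractionalIdeal.mul_mem_mul (FractionalIdeal.mem_coeIdeal_of_mem R⁰ hy) hc)
  rw [mul_div_cancel₀ _ hyK] at hm
  obtain ⟨v, hv, e⟩ := (FractionalIdeal.mem_coeIdeal _).mp hm
  exact hu (IsFractionRing.injective R K e ▸ hv)

end Uniformizer

/-! ### Prime factorization implies that `R` is Krull and `σ = t`. -/

namespace StarOperation

open FractionalIdeal

variable {R K : Type*} [CommRing R] [IsDomain R] [Field K] [Algebra R K] [IsFractionRing R K]
  {σ : StarOperation R K}

/-- If `P * P⁻¹` is not contained in the prime `P`, then `P` is principal locally at `P`. -/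
theorem exists_mul_eq_of_not_mul_inv_le {P : Ideal R} (hP0 : P ≠ ⊥)
    (h : ¬ (P : FractionalIdeal R⁰ K) * (P : FractionalIdeal R⁰ K)⁻¹ ≤ P) :
    ∃ b ∈ P, ∃ s, s ∉ P ∧ ∀ y ∈ P, ∃ r, s * y = b * r := by
  rw [FractionalIdeal.mul_le] at h
  push Not at h
  obtain ⟨b', hb', c, hc, hbc⟩ := h
  obtain ⟨b, hb, rfl⟩ := (mem_coeIdeal _).mp hb'
  have hP0' : (P : FractionalIdeal R⁰ K) ≠ 0 := coeIdeal_ne_zero.mpr hP0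
  rw [mem_inv_iff hP0'] at hc
  obtain ⟨s, hs⟩ := (mem_one_iff _).mp (hc _ hb')
  -- Here `s = cb` with `c ∈ P⁻¹`, so `s * y = b * (c * y)` and `c * y ∈ R` for each `y ∈ P`.
  refine ⟨b, hb, s, fun hsP => hbc ?_, fun y hy => ?_⟩
  · rw [mul_comm, ← hs]
    exact mem_coeIdeal_of_mem _ hsP
  · obtain ⟨r, hr⟩ := (mem_one_iff _).mp (hc _ (mem_coeIdeal_of_mem _ hy))
    refine ⟨r, IsFractionRing.injective R K ?_⟩
    rw [map_mul, map_mul, hs, hr]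
    ring

/-- From `sP ⊆ (b)` follows `s ^ n P ^ n ⊆ (b ^ n)`, and since principal ideals are σ-closed the
inclusion survives replacing `P ^ n` by `(P ^ n)^σ`. It bounds below the order at `P` of elements of
a σ-power. -/
theorem exists_pow_mul_eq_of_mem_map_pow {P : Ideal R} {b s : R} (hb0 : b ≠ 0)
    (h : ∀ y ∈ P, ∃ r, s * y = b * r) (n : ℕ) {y : R}
    (hy : algebraMap R K y ∈ σ ((P ^ n : Ideal R) : FractionalIdeal R⁰ K)) :
    ∃ r, s ^ n * y = b ^ n * r := by
  have h1 : Ideal.span {s} * P ≤ Ideal.span {b} := by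
    rw [Ideal.span_singleton_mul_le_iff]
    intro y hy
    exact Ideal.mem_span_singleton.mpr (h y hy)
  have h2 : ((Ideal.span {s ^ n} * P ^ n : Ideal R) : FractionalIdeal R⁰ K) ≤
      ((Ideal.span {b ^ n} : Ideal R) : FractionalIdeal R⁰ K) := by
    rw [coeIdeal_le_coeIdeal, ← Ideal.span_singleton_pow, ← Ideal.span_singleton_pow, ← mul_pow]
    exact Ideal.pow_right_mono h1 n
  have h3 := map_le_of_isStarIdeal (σ.isStarIdeal_span_singleton (pow_ne_zero n hb0)) h2
  rw [coeIdeal_mul] at h3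
  have h4 := h3 ((σ.map_mul_le _ _) (mul_mem_mul (mem_coeIdeal_of_mem _
    (Ideal.mem_span_singleton_self (s ^ n))) hy))
  obtain ⟨x, hx, e⟩ := (mem_coeIdeal _).mp h4
  obtain ⟨r, rfl⟩ := Ideal.mem_span_singleton.mp hx
  rw [← map_mul] at e
  exact ⟨r, (IsFractionRing.injective R K e).symm⟩

theorem IsInvertibleMaximal.not_mul_inv_le {P : Ideal R} (hP : σ.IsInvertibleMaximal P) :
    ¬ (P : FractionalIdeal R⁰ K) * (P : FractionalIdeal R⁰ K)⁻¹ ≤ P := by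
  intro h
  have h1 := map_le_of_isStarIdeal hP.isStarPrime.2 h
  rw [hP.isStarInvertible.2] at h1
  exact hP.isStarPrime.1.ne_top
    ((coeIdeal_eq_one.mp (le_antisymm coeIdeal_le_one h1)).trans Ideal.one_eq_top)

namespace HasPrimeFactorization

variable (h : σ.HasPrimeFactorization)
include h

theorem exists_isInvertibleMaximal_le {P : Ideal R} (hP : P.IsPrime) {y : R} (hy : y ∈ P)
    {s : Multiset (Ideal R)} (hs : ((Ideal.span {y} : Ideal R) : FractionalIdeal R⁰ K) =
      σ ((s.prod : Ideal R) : FractionalIdeal R⁰ K)) : ∃ Q ∈ s, Q ≤ P :=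
  exists_le_of_map_prod_le hs hP ((Ideal.span_singleton_le_iff_mem P).mpr hy)

theorem exists_isUniformizerAt {P : Ideal R} (hP : σ.IsInvertibleMaximal P) :
    ∃ π, IsUniformizerAt P π := by
  classical
  obtain ⟨π, hπ, s, hs, hsπ⟩ :=
    exists_mul_eq_of_not_mul_inv_le hP.isStarPrime.2.1 hP.not_mul_inv_le
  have hPp := hP.isStarPrime.1
  have hs0 : s ≠ 0 := fun e => hs (e ▸ P.zero_mem)
  have hπ0 : π ≠ 0 := by
    rintro rfl
    obtain ⟨y, hy, hy0⟩ := Submodule.exists_mem_ne_zero_of_ne_bot hP.isStarPrime.2.1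
    obtain ⟨r, hr⟩ := hsπ y hy
    rw [zero_mul] at hr
    exact mul_ne_zero hs0 hy0 hr
  refine ⟨π, hπ, fun y hy => ?_⟩
  obtain ⟨t, ht, e⟩ := h y hy
  -- The order of `y` at `P` is the multiplicity of `P` in its factorization; the other primes
  -- multiply to an ideal outside `P`.
  have hsplit : t.prod = P ^ t.count P * (t.filter (fun Q => ¬ P = Q)).prod := by
    conv_lhs => rw [← Multiset.filter_add_not (fun Q => P = Q) t]
    rw [Multiset.prod_add, Multiset.filter_eq, Multiset.prod_replicate]
  have hC : ¬ (t.filter (fun Q => ¬ P = Q)).prod ≤ P := by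
    intro hle
    obtain ⟨Q, hQ, hQP⟩ := hPp.multiset_prod_le.mp hle
    obtain ⟨hQt, hne⟩ := Multiset.mem_filter.mp hQ
    exact hne ((ht Q hQt).eq_of_le hP.isStarPrime hQP).symm
  set n := t.count P
  set C := (t.filter (fun Q => ¬ P = Q)).prod
  rw [hsplit] at e
  have hyσ : algebraMap R K y ∈ σ ((P ^ n : Ideal R) : FractionalIdeal R⁰ K) := by
    have hmem : algebraMap R K y ∈ ((Ideal.span {y} : Ideal R) : FractionalIdeal R⁰ K) :=
      mem_coeIdeal_of_mem _ (Ideal.mem_span_singleton_self y)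
    rw [e] at hmem
    have hle : P ^ n * C ≤ P ^ n := Ideal.mul_le_left
    exact map_mono ((coeIdeal_le_coeIdeal K).mpr hle) hmem
  obtain ⟨w, hw⟩ := exists_pow_mul_eq_of_mem_map_pow hπ0 hsπ n hyσ
  -- To see `w ∉ P`: with `c ∈ C` outside `P`, the element `π ^ n * c` is a multiple `y * z`.
  -- Combined with `s ^ n * y = π ^ n * w` this gives `w * z = s ^ n * c ∉ P`.
  obtain ⟨c, hcC, hcP⟩ := Set.not_subset.mp hC
  have hmem : π ^ n * c ∈ Ideal.span {y} := by
    have := (σ.le_map _).trans e.ge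
    rw [coeIdeal_le_coeIdeal] at this
    exact this (Ideal.mul_mem_mul (Ideal.pow_mem_pow hπ n) hcC)
  obtain ⟨z, hz⟩ := Ideal.mem_span_singleton.mp hmem
  have hsn : s ^ n ∉ P := fun hm => hs (hPp.mem_of_pow_mem n hm)
  refine ⟨n, s ^ n, w, hsn, fun hwP => ?_, by rw [hw, mul_comm]⟩
  refine hPp.mul_notMem hsn hcP ?_
  have : w * z = s ^ n * c := by
    refine mul_left_cancel₀ (pow_ne_zero n hπ0) ?_
    linear_combination (-z) * hw - s ^ n * hz
  rw [← this]
  exact P.mul_mem_right z hwP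

/-- For nonzero `y ∈ I`, the ideal `I` is σ-comaximal to every prime factor of `(y)`, hence to `(y)`
itself, which it contains. -/
theorem map_eq_one {I : Ideal R} (hI0 : I ≠ ⊥)
    (hI : ∀ P : Ideal R, σ.IsInvertibleMaximal P → ¬ I ≤ P) :
    σ (I : FractionalIdeal R⁰ K) = 1 := by
  obtain ⟨y, hyI, hy⟩ := Submodule.exists_mem_ne_zero_of_ne_bot hI0
  obtain ⟨t, ht, e⟩ := h y hy
  have h1 : σ ((I : FractionalIdeal R⁰ K) ⊔ ((t.prod : Ideal R) : FractionalIdeal R⁰ K)) = 1 := by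
    refine map_sup_prod_eq_one coeIdeal_le_one t fun P hP => ?_
    rw [sup_comm, ← starComaximal_iff]
    exact (ht P hP).starComaximal I (hI P (ht P hP))
  rwa [← map_sup_map, ← e, sup_eq_left.mpr] at h1
  exact (coeIdeal_le_coeIdeal K).mpr ((Ideal.span_singleton_le_iff_mem I).mpr hyI)

theorem dvd_of_forall {a b : R} (hb : b ≠ 0)
    (hab : ∀ P : Ideal R, σ.IsInvertibleMaximal P → ∃ s, s ∉ P ∧ b ∣ a * s) : b ∣ a := by
  by_cases ha : a = 0
  · rw [ha]; exact dvd_zero b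
  -- The conductor `(b : a)`. It lies in none of the primes, so its closure is `R`, and closing `aI
  -- ⊆ (b)` gives `a ∈ (b)`.
  let I : Ideal R := Submodule.comap (LinearMap.mulLeft R a) (Ideal.span {b})
  have hI : ∀ x, x ∈ I ↔ b ∣ a * x := fun x => Ideal.mem_span_singleton
  have hI1 : σ (I : FractionalIdeal R⁰ K) = 1 := by
    refine h.map_eq_one (Submodule.ne_bot_iff _ |>.mpr ⟨b, (hI b).mpr (dvd_mul_left b a), hb⟩) ?_
    intro P hP hle
    obtain ⟨s, hs, hd⟩ := hab P hP
    exact hs (hle ((hI s).mpr hd))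
  have h1 : ((Ideal.span {a} * I : Ideal R) : FractionalIdeal R⁰ K) ≤
      ((Ideal.span {b} : Ideal R) : FractionalIdeal R⁰ K) := by
    rw [coeIdeal_le_coeIdeal, Ideal.span_singleton_mul_le_iff]
    exact fun x hx => hx
  have h2 := map_le_of_isStarIdeal (σ.isStarIdeal_span_singleton hb) h1
  rw [coeIdeal_mul, ← map_mul_map, hI1, mul_one, (σ.isStarIdeal_span_singleton ha).2,
    coeIdeal_le_coeIdeal, Ideal.span_singleton_le_iff_mem] at h2
  exact Ideal.mem_span_singleton.mp h2

theorem eq_of_isPrime_le {P Q : Ideal R} (hP : σ.IsInvertibleMaximal P) (hQ : Q.IsPrime)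
    (hQ0 : Q ≠ ⊥) (hle : Q ≤ P) : Q = P := by
  obtain ⟨y, hyQ, hy⟩ := Submodule.exists_mem_ne_zero_of_ne_bot hQ0
  obtain ⟨t, ht, e⟩ := h y hy
  obtain ⟨T, hT, hTQ⟩ := h.exists_isInvertibleMaximal_le hQ hyQ e
  obtain rfl := (ht T hT).eq_of_le hP.isStarPrime (hTQ.trans hle)
  exact le_antisymm hle hTQ

theorem height_eq_one {P : Ideal R} (hP : σ.IsInvertibleMaximal P) : P.height = 1 := by
  have := hP.isStarPrime.1
  refine le_antisymm ?_ (Order.one_le_iff_ne_zero.mpr fun h0 =>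
    hP.isStarPrime.2.1 (Ideal.height_eq_zero_iff_eq_bot.mp h0))
  rw [← Nat.cast_one, Ideal.height_le_iff]
  intro Q hQ hlt
  have : Q = ⊥ := by
    by_contra hQ0
    exact hlt.ne (h.eq_of_isPrime_le hP hQ hQ0 hlt.le)
  rw [this, Ideal.height_bot]
  simp

theorem mem_of_height_eq_one {P : Ideal R} (hP : P.IsPrime) (hP1 : P.height = 1) {y : R}
    (hy : y ∈ P) {t : Multiset (Ideal R)} (ht : ∀ P ∈ t, σ.IsInvertibleMaximal P)
    (e : ((Ideal.span {y} : Ideal R) : FractionalIdeal R⁰ K) =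
      σ ((t.prod : Ideal R) : FractionalIdeal R⁰ K)) : P ∈ t := by
  obtain ⟨T, hT, hTP⟩ := h.exists_isInvertibleMaximal_le hP hy e
  suffices T = P from this ▸ hT
  -- A factor `T` strictly inside `P` has height one already, which would make the height of `P` at
  -- least two.
  by_contra hne
  have := (ht T hT).isStarPrime.1
  have h1 := Ideal.height_add_one_le_of_lt_of_isPrime (lt_of_le_of_ne hTP hne)
  rw [h.height_eq_one (ht T hT), hP1] at h1
  exact absurd h1 (by decide)

theorem isInvertibleMaximal_iff {P : Ideal R} :
    σ.IsInvertibleMaximal P ↔ P.IsPrime ∧ P.height = 1 := by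
  refine ⟨fun hP => ⟨hP.isStarPrime.1, h.height_eq_one hP⟩, fun ⟨hP, hP1⟩ => ?_⟩
  obtain ⟨y, hyP, hy⟩ := Submodule.exists_mem_ne_zero_of_ne_bot (Ideal.ne_bot_of_height_eq_one hP1)
  obtain ⟨t, ht, e⟩ := h y hy
  exact ht P (h.mem_of_height_eq_one hP hP1 hyP ht e)

theorem isKrullDomain : IsKrullDomain R where
  isDVR P hP hP1 := by
    have hPm := h.isInvertibleMaximal_iff.mpr ⟨hP, hP1⟩
    obtain ⟨π, hπ⟩ := h.exists_isUniformizerAt hPm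
    exact hπ.isDiscreteValuationRing hPm.isStarPrime.2.1
  mem_of_forall x hx := by
    obtain ⟨a, b, hb, rfl⟩ := IsFractionRing.div_surjective (A := R) x
    have hb0 : b ≠ 0 := nonZeroDivisors.ne_zero hb
    have hinj := IsFractionRing.injective R (FractionRing R)
    have hne : ∀ {c : R}, c ≠ 0 → algebraMap R (FractionRing R) c ≠ 0 := fun hc h0 =>
      hc (hinj (by rw [h0, _root_.map_zero]))
    have hd : b ∣ a := by
      refine h.dvd_of_forall hb0 fun P hP => ?_
      obtain ⟨c, s, hs, e⟩ := hx P hP.isStarPrime.1 (h.height_eq_one hP)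
      have hs0 : s ≠ 0 := fun h0 => hs (h0 ▸ P.zero_mem)
      refine ⟨s, hs, c, hinj ?_⟩
      rw [div_eq_div_iff (hne hb0) (hne hs0)] at e
      rw [map_mul, map_mul, e, mul_comm]
    obtain ⟨r, rfl⟩ := hd
    exact ⟨r, by rw [map_mul, mul_div_cancel_left₀ _ (hne hb0)]⟩
  finite x hx := by
    classical
    obtain ⟨t, ht, e⟩ := h x hx
    exact t.toFinset.finite_toSet.subset fun P hP =>
      Multiset.mem_toFinset.mpr (h.mem_of_height_eq_one hP.1 hP.2.1 hP.2.2 ht e)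

/-- `J` is locally principal at each of the primes, and finite generation lets the inverse be
computed locally; so `JJ⁻¹` lies in none of them. -/
theorem map_mul_inv_eq_one_of_fg {J : Ideal R} (hJ : J.FG) (hJ0 : J ≠ ⊥) :
    σ ((J : FractionalIdeal R⁰ K) * (J : FractionalIdeal R⁰ K)⁻¹) = 1 := by
  obtain ⟨A, hA⟩ := le_one_iff_exists_coeIdeal.mp
    (mul_self_inv_le_one (J : FractionalIdeal R⁰ K))
  rw [← hA]
  refine h.map_eq_one ?_ fun P hP hle => ?_
  · rintro rfl
    have h1 := coe_ideal_le_self_mul_inv K J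
    rw [← hA, coeIdeal_le_coeIdeal, le_bot_iff] at h1
    exact hJ0 h1
  · obtain ⟨π, hπ⟩ := h.exists_isUniformizerAt hP
    obtain ⟨y, hy, hy0, hgen⟩ := hπ.exists_local_generator hP.isStarPrime.1 hJ0
    refine not_mul_inv_le_of_fg (K := K) hP.isStarPrime.1 hJ hy hy0 hgen ?_
    rw [← hA]
    exact (coeIdeal_le_coeIdeal K).mpr hle

end HasPrimeFactorization

/-- Every star operation agrees with `v` on the ideals invertible for it: `A⁻¹A^σ ⊆ (A⁻¹A)^σ = R`
bounds `A^σ` above, and multiplying `A⁻¹⁻¹` by `(AA⁻¹)^σ = R` puts it inside `A^σ`. -/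
theorem map_eq_inv_inv {A : FractionalIdeal R⁰ K} (hA : σ (A * A⁻¹) = 1) : σ A = A⁻¹⁻¹ := by
  have hA0 : A ≠ 0 := by
    rintro rfl
    rw [zero_mul, σ.map_zero'] at hA
    exact zero_ne_one hA
  refine le_antisymm (le_inv_of_mul_le_one (inv_ne_zero_of_ne_zero hA0) ?_) ?_
  · rw [← hA, mul_comm A]
    exact σ.map_mul_le A⁻¹ A
  · calc A⁻¹⁻¹ = A⁻¹⁻¹ * σ (A * A⁻¹) := by rw [hA, mul_one]
      _ ≤ σ (A⁻¹⁻¹ * (A * A⁻¹)) := σ.map_mul_le _ _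
      _ ≤ σ A := map_mono (by
        rw [mul_left_comm, mul_comm A⁻¹⁻¹]
        exact (mul_le_mul' le_rfl (mul_self_inv_le_one _)).trans (mul_one _).le)

theorem HasPrimeFactorization.map_eq_inv_inv_of_fg (h : σ.HasPrimeFactorization)
    {J : FractionalIdeal R⁰ K} (hJ : (J : Submodule R K).FG) : σ J = J⁻¹⁻¹ := by
  by_cases hJ0 : J = 0
  · rw [hJ0, σ.map_zero', inv_zero', inv_zero']
  obtain ⟨a, I, ha, rfl⟩ := exists_eq_spanSingleton_mul J
  have haK : algebraMap R K a ≠ 0 := by simpa using ha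
  have hI : I.FG := by
    have h1 := spanSingleton_mul_fg (algebraMap R K a) hJ
    rw [← mul_assoc, spanSingleton_mul_spanSingleton, mul_inv_cancel₀ haK, spanSingleton_one,
      one_mul] at h1
    exact (coeIdeal_fg R⁰ (IsFractionRing.injective R K) I).mp h1
  have hI0 : I ≠ ⊥ := by
    rintro rfl
    simp at hJ0
  refine map_eq_inv_inv (map_mul_mul_inv_eq_one ?_ (h.map_mul_inv_eq_one_of_fg hI hI0))
  rw [spanSingleton_mul_inv K (inv_ne_zero haK), map_one]

theorem HasPrimeFactorization.eq_tOperation (h : σ.HasPrimeFactorization)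
    (hσ : σ.IsFiniteType) : σ = tOperation R K := by
  refine StarOperation.ext (funext fun I => ?_)
  ext x
  -- By finite type, both operations are determined by their values on finitely generated ideals.
  rw [hσ I x]
  change _ ↔ x ∈ (vOperation R K).finiteTypeClosure I
  rw [mem_finiteTypeClosure]
  refine exists_congr fun J => and_congr_right fun _ => and_congr_right fun hJ => ?_
  rw [h.map_eq_inv_inv_of_fg hJ]
  rfl

end StarOperation

/-! ### Prime factorization for the `t`-operation of a Krull domain. -/

namespace IsKrullDomain

open FractionalIdeal StarOperation

variable {R : Type*} [CommRing R] [IsDomain R] (hR : IsKrullDomain R)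
include hR

theorem dvd_of_forall {a b : R} (hb : b ≠ 0)
    (hab : ∀ P : Ideal R, P.IsPrime → P.height = 1 → ∃ s, s ∉ P ∧ b ∣ a * s) : b ∣ a := by
  have hinj := IsFractionRing.injective R (FractionRing R)
  have hne : ∀ {c : R}, c ≠ 0 → algebraMap R (FractionRing R) c ≠ 0 := fun hc h0 =>
    hc (hinj (by rw [h0, _root_.map_zero]))
  obtain ⟨r, hr⟩ := hR.mem_of_forall
    (algebraMap R (FractionRing R) a / algebraMap R (FractionRing R) b) fun P hP hP1 => by
      obtain ⟨s, hs, c, hc⟩ := hab P hP hP1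
      have hs0 : s ≠ 0 := fun h0 => hs (h0 ▸ P.zero_mem)
      refine ⟨c, s, hs, ?_⟩
      rw [div_eq_div_iff (hne hb) (hne hs0), ← map_mul, ← map_mul, hc, mul_comm]
  rw [eq_div_iff (hne hb), ← map_mul] at hr
  exact ⟨r, by rw [← hinj hr, mul_comm]⟩

theorem exists_isUniformizerAt {P : Ideal R} (hP : P.IsPrime) (hP1 : P.height = 1) :
    ∃ π, IsUniformizerAt P π := by
  have := hR.isDVR P hP1
  exact _root_.exists_isUniformizerAt P

theorem exists_local_generator {P : Ideal R} (hP : P.IsPrime) (hP1 : P.height = 1) {I : Ideal R}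
    (hI : I ≠ ⊥) : ∃ y ∈ I, y ≠ 0 ∧ ∀ z ∈ I, ∃ u, u ∉ P ∧ y ∣ u * z := by
  obtain ⟨π, hπ⟩ := hR.exists_isUniformizerAt hP hP1
  exact hπ.exists_local_generator hP hI

/-- A nonzero `a ∈ I` is a local unit, hence a local generator of `I`, at all but the finitely many
height-one primes containing it. Adding to `a` one local generator for each of those gives `J`. -/
theorem exists_fg_le {I : Ideal R} (hI : I ≠ ⊥) : ∃ J : Ideal R, J ≤ I ∧ J.FG ∧ J ≠ ⊥ ∧
    ∀ P : Ideal R, P.IsPrime → P.height = 1 →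
      ∃ y ∈ J, y ≠ 0 ∧ ∀ z ∈ I, ∃ u, u ∉ P ∧ y ∣ u * z := by
  obtain ⟨a, haI, ha⟩ := Submodule.exists_mem_ne_zero_of_ne_bot hI
  have hex : ∀ P : Ideal R, ∃ y ∈ I, P.IsPrime → P.height = 1 →
      y ≠ 0 ∧ ∀ z ∈ I, ∃ u, u ∉ P ∧ y ∣ u * z := fun P => by
    by_cases h : P.IsPrime ∧ P.height = 1
    · obtain ⟨y, hy, h'⟩ := hR.exists_local_generator h.1 h.2 hI
      exact ⟨y, hy, fun _ _ => h'⟩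
    · exact ⟨a, haI, fun h1 h2 => absurd ⟨h1, h2⟩ h⟩
  choose f hfI hf using hex
  have hfin := hR.finite a ha
  have haJ : a ∈ Ideal.span (insert a (f '' {P | P.IsPrime ∧ P.height = 1 ∧ a ∈ P})) :=
    Ideal.subset_span (Set.mem_insert _ _)
  refine ⟨Ideal.span (insert a (f '' {P | P.IsPrime ∧ P.height = 1 ∧ a ∈ P})), ?_, ?_, ?_, ?_⟩
  · rw [Ideal.span_le, Set.insert_subset_iff]
    refine ⟨haI, ?_⟩
    rintro _ ⟨P, -, rfl⟩
    exact hfI P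
  · exact Submodule.fg_span ((hfin.image f).insert a)
  · exact (Submodule.ne_bot_iff _).mpr ⟨a, haJ, ha⟩
  · intro P hP hP1
    by_cases haP : a ∈ P
    · exact ⟨f P, Ideal.subset_span (Set.mem_insert_of_mem _ ⟨P, ⟨hP, hP1, haP⟩, rfl⟩),
        hf P hP hP1⟩
    · exact ⟨a, haJ, ha, fun z _ => ⟨a, haP, dvd_mul_right a z⟩⟩

variable {K : Type*} [Field K] [Algebra R K] [IsFractionRing R K]

theorem inv_eq_of_local_generators {I J : Ideal R} (hJI : J ≤ I) (hJ : J ≠ ⊥)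
    (h : ∀ P : Ideal R, P.IsPrime → P.height = 1 →
      ∃ y ∈ J, y ≠ 0 ∧ ∀ z ∈ I, ∃ u, u ∉ P ∧ y ∣ u * z) :
    (J : FractionalIdeal R⁰ K)⁻¹ = (I : FractionalIdeal R⁰ K)⁻¹ := by
  have hI : I ≠ ⊥ := fun h0 => hJ (le_bot_iff.mp (h0 ▸ hJI))
  have hJ' : (J : FractionalIdeal R⁰ K) ≠ 0 := coeIdeal_ne_zero.mpr hJ
  have hI' : (I : FractionalIdeal R⁰ K) ≠ 0 := coeIdeal_ne_zero.mpr hI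
  have hinj := IsFractionRing.injective R K
  refine le_antisymm (fun c hc => ?_)
    (inv_anti_mono hJ' hI' ((coeIdeal_le_coeIdeal K).mpr hJI))
  rw [mem_inv_iff hJ'] at hc
  rw [mem_inv_iff hI']
  obtain ⟨p, q, hq, rfl⟩ := IsFractionRing.div_surjective (A := R) c
  have hq0 : q ≠ 0 := nonZeroDivisors.ne_zero hq
  have hqK : algebraMap R K q ≠ 0 := fun h0 => hq0 (hinj (by rw [h0, _root_.map_zero]))
  intro x hx
  obtain ⟨z, hz, rfl⟩ := (mem_coeIdeal _).mp hx
  -- Divisibility may be checked at each height-one prime, where `u * z = y * r` and `p * y = q * m`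
  -- give `p * z * u = q * (m * r)`.
  have hd : q ∣ p * z := by
    refine hR.dvd_of_forall hq0 fun P hP hP1 => ?_
    obtain ⟨y, hy, -, hgen⟩ := h P hP hP1
    obtain ⟨u, hu, r, hr⟩ := hgen z hz
    obtain ⟨m, hm⟩ := (mem_one_iff _).mp (hc _ (mem_coeIdeal_of_mem _ hy))
    rw [div_mul_eq_mul_div, eq_div_iff hqK, ← map_mul, ← map_mul] at hm
    refine ⟨u, hu, m * r, ?_⟩
    linear_combination p * hr - r * hinj hm
  obtain ⟨r, hr⟩ := hd
  exact (mem_one_iff _).mpr ⟨r, by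
    rw [div_mul_eq_mul_div, ← map_mul, hr, map_mul, mul_div_cancel_left₀ _ hqK]⟩

theorem tOperation_eq_inv_inv (I : Ideal R) :
    tOperation R K (I : FractionalIdeal R⁰ K) = (I : FractionalIdeal R⁰ K)⁻¹⁻¹ := by
  refine le_antisymm ((vOperation R K).finiteTypeClosure_le _) ?_
  by_cases hI : I = ⊥
  · rw [hI, coeIdeal_bot, inv_zero', inv_zero']
    exact FractionalIdeal.zero_le _
  obtain ⟨J, hJI, hJf, hJ0, hgen⟩ := hR.exists_fg_le hI
  intro x hx
  refine ⟨J, (coeIdeal_le_coeIdeal K).mpr hJI,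
    (coeIdeal_fg R⁰ (IsFractionRing.injective R K) J).mpr hJf, ?_⟩
  change x ∈ (J : FractionalIdeal R⁰ K)⁻¹⁻¹
  rwa [hR.inv_eq_of_local_generators hJI hJ0 hgen]

theorem tOperation_eq_one {I : Ideal R} (hI0 : I ≠ ⊥)
    (hI : ∀ P : Ideal R, P.IsPrime → P.height = 1 → ¬ I ≤ P) :
    tOperation R K (I : FractionalIdeal R⁰ K) = 1 := by
  -- At each height-one prime an element of `I` outside it generates `R` locally, so `I` has the
  -- same inverse as `R`.
  rw [hR.tOperation_eq_inv_inv, hR.inv_eq_of_local_generators (I := ⊤) le_top hI0, coeIdeal_top,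
    inv_one, inv_one]
  intro P hP hP1
  obtain ⟨y, hyI, hyP⟩ := Set.not_subset.mp (hI P hP hP1)
  exact ⟨y, hyI, fun h0 => hyP (h0 ▸ P.zero_mem), fun z _ => ⟨y, hyP, dvd_mul_right y z⟩⟩

theorem not_mul_inv_le {I : Ideal R} (hI : I ≠ ⊥) {P : Ideal R} (hP : P.IsPrime)
    (hP1 : P.height = 1) :
    ¬ (I : FractionalIdeal R⁰ K) * (I : FractionalIdeal R⁰ K)⁻¹ ≤ P := by
  obtain ⟨J, hJI, hJf, hJ0, hgen⟩ := hR.exists_fg_le hI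
  obtain ⟨y, hy, hy0, hy'⟩ := hgen P hP hP1
  intro hle
  refine not_mul_inv_le_of_fg (K := K) hP hJf hy hy0 (fun z hz => hy' z (hJI hz)) ?_
  rw [hR.inv_eq_of_local_generators hJI hJ0 hgen]
  exact (mul_le_mul' ((coeIdeal_le_coeIdeal K).mpr hJI) le_rfl).trans hle

theorem isStarInvertible {I : Ideal R} (hI : I ≠ ⊥) : (tOperation R K).IsStarInvertible I := by
  refine ⟨hI, ?_⟩
  obtain ⟨A, hA⟩ := le_one_iff_exists_coeIdeal.mp
    (mul_self_inv_le_one (I : FractionalIdeal R⁰ K))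
  rw [← hA]
  refine hR.tOperation_eq_one ?_ fun P hP hP1 hle => hR.not_mul_inv_le (K := K) hI hP hP1 ?_
  · rintro rfl
    have h1 := coe_ideal_le_self_mul_inv K I
    rw [← hA, coeIdeal_le_coeIdeal, le_bot_iff] at h1
    exact hI h1
  · rw [← hA]
    exact (coeIdeal_le_coeIdeal K).mpr hle

theorem isInvertibleMaximal {P : Ideal R} (hP : P.IsPrime) (hP1 : P.height = 1) :
    (tOperation R K).IsInvertibleMaximal P := by
  have hP0 := Ideal.ne_bot_of_height_eq_one hP1
  refine ⟨⟨hP, hP0, ?_⟩, hR.isStarInvertible hP0, fun I hI => ?_⟩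
  · refine le_antisymm ?_ ((tOperation R K).le_map _)
    -- `PP⁻¹ · P_t ⊆ P` because `P_t = P⁻¹⁻¹`, and `PP⁻¹` is not inside the prime `P`; so `P_t ⊆ P`.
    refine ((mul_le_coeIdeal_iff hP (mul_self_inv_le_one (P : FractionalIdeal R⁰ K))
      (map_le_one coeIdeal_le_one)).mp ?_).resolve_left (hR.not_mul_inv_le hP0 hP hP1)
    rw [hR.tOperation_eq_inv_inv, mul_assoc]
    exact (mul_le_mul' le_rfl (mul_self_inv_le_one _)).trans (mul_one _).le
  -- A height-one prime containing `P + I` would equal `P` and so contain `I`.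
  · refine hR.tOperation_eq_one (fun h0 => hP0 ?_) fun Q hQ hQ1 hle => hI ?_
    · exact le_bot_iff.mp (h0 ▸ le_sup_left)
    · have hPQ : P ≤ Q := le_sup_left.trans hle
      have : P = Q := by
        by_contra hne
        have h1 := Ideal.height_add_one_le_of_lt_of_isPrime (lt_of_le_of_ne hPQ hne)
        rw [hP1, hQ1] at h1
        exact absurd h1 (by decide)
      exact this ▸ le_sup_right.trans hle

/-- The `t`-powers of a height-one prime have zero intersection. -/
theorem exists_notMem_tOperation_pow {P : Ideal R} (hP : P.IsPrime) (hP1 : P.height = 1) {y : R}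
    (hy : y ≠ 0) :
    ∃ n : ℕ, algebraMap R K y ∉ tOperation R K ((P ^ n : Ideal R) : FractionalIdeal R⁰ K) := by
  have hP0 := Ideal.ne_bot_of_height_eq_one hP1
  obtain ⟨π, hπ⟩ := hR.exists_isUniformizerAt hP hP1
  obtain ⟨b, hb, s, hs, hsb⟩ := exists_mul_eq_of_not_mul_inv_le hP0
    (hR.not_mul_inv_le (K := FractionRing R) hP0 hP hP1)
  have hb0 : b ≠ 0 := by
    rintro rfl
    obtain ⟨z, hz, hz0⟩ := Submodule.exists_mem_ne_zero_of_ne_bot hP0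
    obtain ⟨r, hr⟩ := hsb z hz
    rw [zero_mul] at hr
    have hs0 : s ≠ 0 := by
      rintro rfl
      exact hs P.zero_mem
    exact mul_ne_zero hs0 hz0 hr
  obtain ⟨n, u, w, hu, hw, e⟩ := hπ.exists_eq y hy
  -- Here `y` has order `n` at `P`, while elements of `(P ^ (n + 1))_t` are locally multiples of `b
  -- ^ (n + 1)`, and `b ∈ P` is locally a multiple of `π`.
  refine ⟨n + 1, fun hmem => ?_⟩
  obtain ⟨r, hr⟩ := exists_pow_mul_eq_of_mem_map_pow hb0 hsb _ hmem
  obtain ⟨v, hv, c, hc⟩ := hπ.dvd_of_mem hP hb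
  have hN : ∀ {x : R}, x ∉ P → x ^ (n + 1) ∉ P := fun hx hm => hx (hP.mem_of_pow_mem _ hm)
  refine hP.mul_notMem (hP.mul_notMem (hN hv) (hN hs)) hw ?_
  have key : v ^ (n + 1) * s ^ (n + 1) * w = u * c ^ (n + 1) * r * π := by
    refine mul_right_cancel₀ (pow_ne_zero n (hπ.ne_zero hP hP0)) ?_
    have hc' : v ^ (n + 1) * b ^ (n + 1) = π ^ n * π * c ^ (n + 1) := by
      rw [← mul_pow, hc, mul_pow, pow_succ π]
    linear_combination (-v ^ (n + 1) * s ^ (n + 1)) * e + u * v ^ (n + 1) * hr + u * r * hc'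
  rw [key]
  exact P.mul_mem_left _ hπ.mem

theorem exists_multiset_eq_map_prod {X : Ideal R} (hX : (tOperation R K).IsStarIdeal X) :
    ∃ t : Multiset (Ideal R), (∀ P ∈ t, (tOperation R K).IsInvertibleMaximal P) ∧
      (X : FractionalIdeal R⁰ K) = tOperation R K ((t.prod : Ideal R) : FractionalIdeal R⁰ K) := by
  classical
  -- Induction on the number of height-one primes containing `X`; each step removes one of them
  -- completely.
  induction hn : {P : Ideal R | P.IsPrime ∧ P.height = 1 ∧ X ≤ P}.ncard using
    Nat.strong_induction_on generalizing X with | _ n ih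
  subst hn
  obtain ⟨y, hyX, hy⟩ := Submodule.exists_mem_ne_zero_of_ne_bot hX.1
  have hfin : {P : Ideal R | P.IsPrime ∧ P.height = 1 ∧ X ≤ P}.Finite :=
    (hR.finite y hy).subset fun P hP => ⟨hP.1, hP.2.1, hP.2.2 hyX⟩
  by_cases hex : ∃ P : Ideal R, P.IsPrime ∧ P.height = 1 ∧ X ≤ P
  swap
  · push Not at hex
    refine ⟨0, by simp, ?_⟩
    rw [← hX.2, hR.tOperation_eq_one hX.1 hex, Multiset.prod_zero, Ideal.one_eq_top, coeIdeal_top,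
      (tOperation R K).map_one]
  obtain ⟨P, hP, hP1, hXP⟩ := hex
  have hPm := hR.isInvertibleMaximal (K := K) hP hP1
  have hN : ∃ N : ℕ, ¬ (X : FractionalIdeal R⁰ K) ≤
      tOperation R K ((P ^ N : Ideal R) : FractionalIdeal R⁰ K) := by
    obtain ⟨N, hN⟩ := hR.exists_notMem_tOperation_pow (K := K) hP hP1 hy
    exact ⟨N, fun hle => hN (hle (mem_coeIdeal_of_mem _ hyX))⟩
  -- The first failing exponent is not `0`, since `P ^ 0 = R` contains `X`. So `m` is the last
  -- exponent with `X ⊆ (P ^ m)_t`, the order of `X` at `P`.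
  obtain ⟨m, hm⟩ : ∃ m, Nat.find hN = m + 1 := by
    refine Nat.exists_eq_succ_of_ne_zero fun h0 => Nat.find_spec hN ?_
    rw [h0, pow_zero, Ideal.one_eq_top, coeIdeal_top, (tOperation R K).map_one]
    exact coeIdeal_le_one
  have hXm : (X : FractionalIdeal R⁰ K) ≤
      tOperation R K ((P ^ m : Ideal R) : FractionalIdeal R⁰ K) :=
    not_not.mp (Nat.find_min hN (by lia))
  have hXm1 := Nat.find_spec hN
  rw [hm] at hXm1
  have hB : tOperation R K (((P ^ m : Ideal R) : FractionalIdeal R⁰ K) *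
      ((P ^ m : Ideal R) : FractionalIdeal R⁰ K)⁻¹) = 1 := by
    rw [coeIdeal_pow]
    exact map_pow_mul_inv_eq_one hPm.isStarInvertible.2 m
  have hA1 : ((P ^ m : Ideal R) : FractionalIdeal R⁰ K)⁻¹ * X ≤ 1 := by
    rw [← hB, mul_comm ((P ^ m : Ideal R) : FractionalIdeal R⁰ K)]
    exact (mul_le_mul' le_rfl hXm).trans ((tOperation R K).map_mul_le _ _)
  -- `Y` is the `t`-quotient of `X` by `P ^ m`. By the choice of `m` it is not inside `P`, and it
  -- contains `X`, so its height-one primes are those of `X` with at least `P` removed.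
  obtain ⟨Y, hY⟩ := le_one_iff_exists_coeIdeal.mp (map_le_one (σ := tOperation R K) hA1)
  have hXA : X ≤ Y := by
    rw [← coeIdeal_le_coeIdeal K, hY]
    refine le_trans ?_ ((tOperation R K).le_map _)
    conv_lhs => rw [← one_mul (X : FractionalIdeal R⁰ K)]
    refine mul_le_mul' (le_inv_of_mul_le_one ?_ ?_) le_rfl
    · exact coeIdeal_ne_zero.mpr (pow_ne_zero m hPm.isStarPrime.2.1)
    · rw [mul_one]; exact coeIdeal_le_one
  have hXY : (X : FractionalIdeal R⁰ K) =
      tOperation R K (((P ^ m : Ideal R) : FractionalIdeal R⁰ K) * Y) := by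
    rw [hY, map_mul_map, map_inv_mul_mul hB, hX.2]
  have hYP : ¬ Y ≤ P := fun hle => hXm1 <| by
    rw [hXY, pow_succ, coeIdeal_mul]
    exact map_mono (mul_le_mul' le_rfl ((coeIdeal_le_coeIdeal K).mpr hle))
  have hYs : (tOperation R K).IsStarIdeal Y :=
    ⟨fun h0 => hX.1 (le_bot_iff.mp (h0 ▸ hXA)), by rw [hY, map_map]⟩
  obtain ⟨t, ht, e⟩ := ih _ (Set.ncard_lt_ncard
    ⟨fun Q hQ => ⟨hQ.1, hQ.2.1, hXA.trans hQ.2.2⟩, fun hle => hYP (hle ⟨hP, hP1, hXP⟩).2.2⟩ hfin)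
    hYs rfl
  refine ⟨Multiset.replicate m P + t, fun Q hQ => ?_, ?_⟩
  · rcases Multiset.mem_add.mp hQ with hQ | hQ
    · rwa [Multiset.eq_of_mem_replicate hQ]
    · exact ht Q hQ
  · rw [hXY, e, map_mul_map, Multiset.prod_add, Multiset.prod_replicate, coeIdeal_mul]

theorem hasPrimeFactorization : (tOperation R K).HasPrimeFactorization := fun _ hy =>
  hR.exists_multiset_eq_map_prod ((tOperation R K).isStarIdeal_span_singleton hy)

end IsKrullDomain

theorem mainTheorem6 {R K : Type*} [CommRing R] [IsDomain R] [Field K] [Algebra R K]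
    [IsFractionRing R K] (σ : StarOperation R K) (hσ : σ.IsFiniteType) :
    (σ.IsURD ∧ ∀ I : Ideal R, σ.IsPacket I → σ.IsStarPowerOfStarPrime I) ↔
      (IsKrullDomain R ∧ σ = tOperation R K) := by
  rw [StarOperation.isURD_and_packets_iff_hasPrimeFactorization]
  refine ⟨fun h => ⟨h.isKrullDomain, h.eq_tOperation hσ⟩, ?_⟩
  rintro ⟨hR, rfl⟩
  exact hR.hasPrimeFactorization
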